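/- For an integer $k\ge 1$, a $k$-graph $H=(V,E)$ consists of a finite vertex set $V$ and an edge set $E$ of $k$-element subsets of $V$. A copy of a $k$-graph $F$ in $H$ is given by an injective map $V(F)\to V(H)$ that sends every edge of $F$ to an edge of $H$. The extremal number $\mathrm{ex}(n,F)$ is the maximum number of edges in a $k$-graph with $n$ vertices that contains no copy of $F$ (and is $0$ if there is no such $k$-graph), and the Turán density of $F$ is $\pi(F)=\lim_{n\to\infty}\mathrm{ex}(n,F)/\binom{n}{k}$. Let $\Pi^{(k)}=\{\pi(F): F \text{ is a } k\text{-graph}\}\subseteq[0,1]$. A real number $\alpha$ is an accumulation point of a set $S\subseteq\mathbb{R}$ if every neighbourhood of $\alpha$ contains a point of $S$ different from $\alpha$. **Theorem.** For every integer $k\ge 3$, the set $\Pi^{(k)}$ has an accumulation point in $[0,1)$. Moreover, $1/2$ is an accumulation point of $\Pi^{(3)}$. -/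

import Mathlib

open Filter Topology Set

/-- A `k`-uniform hypergraph (`k`-graph) on the vertex set `V`, with a finite set of edges, each of
which is a set of exactly `k` vertices. It is only used with a finite vertex set. -/
structure KGraph (k : ℕ) (V : Type*) where
  edges : Finset (Finset V)
  uniform : ∀ e ∈ edges, e.card = k

namespace KGraph

/-- `H` contains a (not necessarily induced) copy of `F`: some injection of the vertices of `F`
into those of `H` takes every edge of `F` to an edge of `H`. -/
def ContainsCopy {k : ℕ} {V W : Type*} (H : KGraph k W) (F : KGraph k V) : Prop :=
  ∃ f : V ↪ W, ∀ e ∈ F.edges, e.map f ∈ H.edges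

/-- The extremal number `ex(n, F)`: the maximum number of edges in a `k`-graph with `n` vertices
that contains no copy of `F`. The set below is bounded, so this supremum is a maximum, unless there
is no such `k`-graph (which happens only if `F` has no edges), and then the value is `0`. -/
noncomputable def extremalNumber {k : ℕ} {V : Type*} (n : ℕ) (F : KGraph k V) : ℕ :=
  sSup {m : ℕ | ∃ H : KGraph k (Fin n), ¬ H.ContainsCopy F ∧ H.edges.card = m}

/-- `x` is the Turán density of `F`, i.e. `ex(n, F) / (n choose k)` converges to `x` as
`n → ∞`. -/
def IsTuranDensity {k : ℕ} {V : Type*} (F : KGraph k V) (x : ℝ) : Prop :=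
  Tendsto (fun n : ℕ => (extremalNumber n F : ℝ) / (n.choose k : ℝ)) atTop (𝓝 x)

end KGraph

/-- The set `Π^(k)` of the Turán densities of single (finite) `k`-graphs. -/
def turanDensitySet (k : ℕ) : Set ℝ :=
  {x : ℝ | ∃ (V : Type) (_ : Finite V) (F : KGraph k V), F.IsTuranDensity x}

/-! Put `r = k - 1`. The accumulation point is `r! / r ^ r`, the limiting edge density of the
balanced complete `r`-partite `r`-graph; for `r = 2` it is `1/2`. It is approached strictly from
below by the densities of trees of cones: the root is coned over an expansion of `K_{r+1}`, each
base vertex is the root of a further cone, and so on to depth `D`.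

Lower bound (`le_of_isTuranDensity_coneTree`): take `D` levels, each split into `r` colours, with
edges made of a lowest vertex and `r` vertices of distinct colours on higher levels. A root of a
tree of depth `d` has level at least `d`: if its base lies at level `d` or more and it does not lie
above level `d`, it is lowest in all edges of its cone, and the core would need `r + 1` colours. So
depth `D` is impossible, while the density tends to `r! / r ^ r` as `D` grows.

Upper bound (`isTuranDensity_coneTree_lt`): rank each vertex by the depth up to which it robustly
roots trees. Ranks are below `D`. If the link of `v` among vertices of at least its rank robustly
covered all pairs of an `(r + 1)`-set, a cone could be attached and the rank of `v` would be larger.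
Hence, after `O(n ^ r)` deletions (`exists_ranked_subset`), these links have `K_{r+1}`-free shadows,
and Zykov's theorem bounds their size. Summing over ranks only gives density at most `r! / r ^ r`;
strictness (`exists_card_le_of_ranked`) comes from the edges inside one rank class. There every link
is constrained, so by Cauchy–Schwarz such edges are sparser by a factor `r / (r + 1)` than the first
bound allows. A polynomial that interpolates the weight of the class turns this deficit into a loss
proportional to the `(r + 1)`-st power of the class size, and some class has at least `n / D`
vertices. -/

section WeightedCliques

/-! ### Weighted Zykov theorem by symmetrization. -/

open scoped Classical in
/-- **Maclaurin's inequality**: the `j`-th elementary symmetric function of at most `r` nonnegative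
reals with a given sum is largest when there are `r` of them and they are equal. -/
theorem esymm_le_choose_mul_pow {V : Type*} (w : V → ℝ) (hw : ∀ x, 0 ≤ w x) (r : ℕ) :
    ∀ (j : ℕ) (t : Finset V), t.card ≤ r →
      ∑ s ∈ t.powersetCard j, ∏ x ∈ s, w x ≤ (r.choose j : ℝ) * ((∑ x ∈ t, w x) / r) ^ j := by
  induction r with
  | zero =>
    intro j t ht
    have : t = ∅ := Finset.card_eq_zero.mp (Nat.le_zero.mp ht)
    subst this
    cases j with
    | zero => simp
    | succ j => rw [Finset.powersetCard_eq_empty.mpr (by simp)]; simp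
  | succ r ih =>
    intro j t ht
    cases j with
    | zero => simp
    | succ j =>
    rcases t.eq_empty_or_nonempty with rfl | ⟨a, ha⟩
    · rw [Finset.powersetCard_eq_empty.mpr (by simp)]
      simp
    obtain ⟨t', hat, rfl⟩ : ∃ t', a ∉ t' ∧ insert a t' = t :=
      ⟨t.erase a, Finset.notMem_erase a t, Finset.insert_erase ha⟩
    rw [Finset.card_insert_of_notMem hat] at ht
    have ht' : t'.card ≤ r := by omega
    have hsplit : ∑ s ∈ (insert a t').powersetCard (j + 1), ∏ x ∈ s, w x
        = ∑ s ∈ t'.powersetCard (j + 1), ∏ x ∈ s, w x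
          + w a * ∑ s ∈ t'.powersetCard j, ∏ x ∈ s, w x := by
      rw [Finset.powersetCard_succ_insert hat, Finset.sum_union, Finset.sum_image, Finset.mul_sum]
      · congr 1
        refine Finset.sum_congr rfl fun s hs => ?_
        rw [Finset.prod_insert]
        exact fun h => hat ((Finset.mem_powersetCard.mp hs).1 h)
      · intro s hs s' hs' h
        have h1 : a ∉ s := fun h => hat ((Finset.mem_powersetCard.mp hs).1 h)
        have h2 : a ∉ s' := fun h => hat ((Finset.mem_powersetCard.mp hs').1 h)
        simpa [Finset.erase_insert h1, Finset.erase_insert h2] using congrArg (·.erase a) h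
      · rw [Finset.disjoint_left]
        intro s hs hs'
        obtain ⟨s', -, rfl⟩ := Finset.mem_image.mp hs'
        exact hat ((Finset.mem_powersetCard.mp hs).1 (Finset.mem_insert_self _ _))
    rw [hsplit, Finset.sum_insert hat]
    have h1 := ih (j + 1) t' ht'
    have h2 := mul_le_mul_of_nonneg_left (ih j t' ht') (hw a)
    have hS0 : 0 ≤ ∑ x ∈ t', w x := Finset.sum_nonneg fun x _ => hw x
    set m : ℝ := (∑ x ∈ t', w x) / r with hm
    have hm0 : 0 ≤ m := by positivity
    -- For `r = 0` the quotient `m` is `0` by convention, but then `t'` is empty.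
    have hS : ∑ x ∈ t', w x = r * m := by
      rcases Nat.eq_zero_or_pos r with rfl | hr
      · have : t' = ∅ := Finset.card_eq_zero.mp (Nat.le_zero.mp ht')
        simp [this]
      · have : (r : ℝ) ≠ 0 := by positivity
        rw [hm]; field_simp
    rw [hS]
    refine (add_le_add h1 h2).trans ?_
    have hwa := hw a
    set x := w a
    set y : ℝ := (x + r * m) / ((r + 1 : ℕ) : ℝ) with hy
    have hy0 : 0 ≤ y := by positivity
    -- The power lies above its tangent at the old mean `m` (Bernoulli after scaling). Since `x = m
    -- + (r + 1) * (y - m)`, Pascal's rule makes the bound to be proved exactly a binomial multiple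
    -- of this inequality.
    have htan : m ^ (j + 1) + (j + 1) * m ^ j * (y - m) ≤ y ^ (j + 1) := by
      rcases hm0.eq_or_lt with h0 | h0
      · rw [← h0]
        cases j with
        | zero => simp
        | succ j => simpa using pow_nonneg hy0 _
      · have hb := one_add_mul_le_pow (a := y / m - 1) (by
          have : 0 ≤ y / m := by positivity
          linarith) (j + 1)
        have hmul := mul_le_mul_of_nonneg_right hb (pow_nonneg hm0 (j + 1))
        rw [← mul_pow] at hmul
        have e1 : (1 + (y / m - 1)) * m = y := by field_simp; ring
        rw [e1] at hmul
        refine le_trans (le_of_eq ?_) hmul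
        push_cast
        field_simp
        ring
    have hc1 : ((r + 1 : ℕ) : ℝ) * (r.choose j : ℝ) = ((r + 1).choose (j + 1) : ℝ) * (j + 1) := by
      exact_mod_cast Nat.add_one_mul_choose_eq r j
    have hc2 : ((r + 1).choose (j + 1) : ℝ) = r.choose j + r.choose (j + 1) := by
      exact_mod_cast Nat.choose_succ_succ r j
    have hr1 : ((r + 1 : ℕ) : ℝ) ≠ 0 := by positivity
    have hyx : x = (r + 1 : ℕ) * y - r * m := by rw [hy]; field_simp; ring
    refine le_trans (le_of_eq ?_) (mul_le_mul_of_nonneg_left htan (Nat.cast_nonneg _))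
    have hrx : (r.choose j : ℝ) * x
        = (r.choose j : ℝ) * m + ((r + 1).choose (j + 1) : ℝ) * (j + 1) * (y - m) := by
      rw [← hc1, hyx]; push_cast; ring
    calc (r.choose (j + 1) : ℝ) * m ^ (j + 1) + x * (r.choose j * m ^ j)
        = (r.choose (j + 1) : ℝ) * m ^ (j + 1) + (r.choose j * x) * m ^ j := by ring
      _ = _ := by rw [hrx, hc2]; ring

variable {V : Type*} [Fintype V]

open scoped Classical in
/-- The cliques with `j` vertices of the graph `G`. -/
noncomputable def cliquesOfCard (G : SimpleGraph V) (j : ℕ) : Finset (Finset V) :=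
  ((Finset.univ : Finset V).powersetCard j).filter fun s => G.IsClique (s : Set V)

theorem mem_cliquesOfCard {G : SimpleGraph V} {j : ℕ} {s : Finset V} :
    s ∈ cliquesOfCard G j ↔ s.card = j ∧ G.IsClique (s : Set V) := by
  classical
  simp [cliquesOfCard]

/-- The total weight of the cliques with `j` vertices. -/
noncomputable def cliqueWeight (G : SimpleGraph V) (j : ℕ) (w : V → ℝ) : ℝ :=
  ∑ s ∈ cliquesOfCard G j, ∏ x ∈ s, w x

/-- Moving all the weight of one of two nonadjacent vertices to the other, in the right direction,
does not decrease the weight of the cliques. -/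
theorem exists_shift_weight (G : SimpleGraph V) (j : ℕ) (w : V → ℝ) (hw : ∀ x, 0 ≤ w x)
    {u v : V} (huv : u ≠ v) (hadj : ¬ G.Adj u v) (hu : w u ≠ 0) (hv : w v ≠ 0) :
    ∃ w' : V → ℝ, (∀ x, 0 ≤ w' x) ∧ ∑ x, w' x = ∑ x, w x ∧
      cliqueWeight G j w ≤ cliqueWeight G j w' ∧ (∀ x, w x = 0 → w' x = 0) ∧
      ∃ x, w x ≠ 0 ∧ w' x = 0 := by
  classical
  have hu0 : 0 < w u := lt_of_le_of_ne (hw u) hu.symm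
  have hv0 : 0 < w v := lt_of_le_of_ne (hw v) hv.symm
  let shift : V → V → V → ℝ := fun a b => Function.update (Function.update w b 0) a (w a + w b)
  have key : ∀ a b : V, a ≠ b → w a ≠ 0 → w b ≠ 0 →
      (∀ x, 0 ≤ shift a b x) ∧ ∑ x, shift a b x = ∑ x, w x ∧ (∀ x, w x = 0 → shift a b x = 0) ∧
      ∃ x, w x ≠ 0 ∧ shift a b x = 0 := by
    intro a b hab ha hb
    refine ⟨fun x => ?_, ?_, fun x hx => ?_, b, hb, ?_⟩
    · simp only [shift, Function.update_apply]
      split_ifs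
      · exact add_nonneg (hw a) (hw b)
      · exact le_rfl
      · exact hw x
    · have h1 : (Finset.univ : Finset V) = insert a (insert b ((Finset.univ.erase a).erase b)) := by
        ext x; simp; tauto
      have hb' : b ∉ (Finset.univ.erase a).erase b := Finset.notMem_erase _ _
      have ha' : a ∉ insert b ((Finset.univ.erase a).erase b) := by simp [hab]
      rw [h1, Finset.sum_insert ha', Finset.sum_insert hb', Finset.sum_insert ha',
        Finset.sum_insert hb']
      have : ∑ x ∈ (Finset.univ.erase a).erase b, shift a b x
          = ∑ x ∈ (Finset.univ.erase a).erase b, w x := by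
        refine Finset.sum_congr rfl fun x hx => ?_
        simp only [Finset.mem_erase] at hx
        simp [shift, hx.1, hx.2.1]
      rw [this]
      simp [shift, hab.symm]
    · have hxa : x ≠ a := fun h => ha (h ▸ hx)
      have hxb : x ≠ b := fun h => hb (h ▸ hx)
      simp [shift, hxa, hxb, hx]
    · simp [shift, hab.symm]
  -- No clique contains both `u` and `v`, so the clique weight is affine on the segment between the
  -- two shifts, and `w` lies on it. One of the two ends is therefore at least as good.
  have hcomb : w u * cliqueWeight G j (shift u v) + w v * cliqueWeight G j (shift v u)
      = (w u + w v) * cliqueWeight G j w := by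
    simp only [cliqueWeight, Finset.mul_sum]
    rw [← Finset.sum_add_distrib]
    refine Finset.sum_congr rfl fun s hs => ?_
    have hs' := (mem_cliquesOfCard.mp hs).2
    have hoff : ∀ (a b : V) (t : Finset V), a ∉ t → b ∉ t →
        ∏ x ∈ t, shift a b x = ∏ x ∈ t, w x := by
      intro a b t ha hb
      refine Finset.prod_congr rfl fun x hx => ?_
      have hxa : x ≠ a := fun h => ha (h ▸ hx)
      have hxb : x ≠ b := fun h => hb (h ▸ hx)
      simp [shift, hxa, hxb]
    have hon : ∀ a b : V, a ≠ b → a ∈ s → b ∉ s →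
        ∏ x ∈ s, shift a b x = (w a + w b) * ∏ x ∈ s.erase a, w x ∧
        ∏ x ∈ s, shift b a x = 0 ∧ ∏ x ∈ s, w x = w a * ∏ x ∈ s.erase a, w x := by
      intro a b hab ha hb
      refine ⟨?_, Finset.prod_eq_zero ha (by simp [shift, hab]), ?_⟩
      · rw [← Finset.mul_prod_erase s _ ha,
          hoff a b _ (Finset.notMem_erase _ _) (fun h => hb (Finset.mem_of_mem_erase h))]
        simp [shift]
      · rw [Finset.mul_prod_erase s _ ha]
    by_cases h1 : u ∈ s <;> by_cases h2 : v ∈ s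
    · exact absurd (hs' h1 h2 huv) hadj
    · obtain ⟨e1, e2, e3⟩ := hon u v huv h1 h2
      rw [e1, e2, e3]; ring
    · obtain ⟨e1, e2, e3⟩ := hon v u huv.symm h2 h1
      rw [e1, e2, e3]; ring
    · rw [hoff u v s h1 h2, hoff v u s h2 h1]; ring
  by_cases hle : cliqueWeight G j w ≤ cliqueWeight G j (shift u v)
  · obtain ⟨k1, k2, k3, k4⟩ := key u v huv hu hv
    exact ⟨_, k1, k2, hle, k3, k4⟩
  · obtain ⟨k1, k2, k3, k4⟩ := key v u huv.symm hv hu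
    refine ⟨_, k1, k2, ?_, k3, k4⟩
    by_contra hlt
    push Not at hle hlt
    nlinarith

/-- The weighted form of Zykov's theorem: in a graph without cliques of size `r + 1`, the cliques
of size `j` weigh at most as much as in the balanced complete `r`-partite graph. -/
theorem cliqueWeight_le (G : SimpleGraph V) {r : ℕ} (hG : cliquesOfCard G (r + 1) = ∅) (j : ℕ)
    (w : V → ℝ) (hw : ∀ x, 0 ≤ w x) :
    cliqueWeight G j w ≤ (r.choose j : ℝ) * ((∑ x, w x) / r) ^ j := by
  classical
  -- Shifts shrink the support until it is a clique; it then has at most `r` vertices and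
  -- Maclaurin's inequality applies.
  induction h : (Finset.univ.filter fun x => w x ≠ 0).card using Nat.strong_induction_on
    generalizing w with
  | _ m ih =>
  by_cases hcl : G.IsClique ((Finset.univ.filter fun x => w x ≠ 0 : Finset V) : Set V)
  · set t := Finset.univ.filter fun x => w x ≠ 0 with ht
    have htr : t.card ≤ r := by
      by_contra hlt
      obtain ⟨s, hs, hsc⟩ := Finset.exists_subset_card_eq (show r + 1 ≤ t.card by omega)
      have : s ∈ cliquesOfCard G (r + 1) :=
        mem_cliquesOfCard.mpr ⟨hsc, hcl.subset (Finset.coe_subset.mpr hs)⟩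
      simp [hG] at this
    have h1 := esymm_le_choose_mul_pow w hw r j t htr
    have h2 : ∑ x ∈ t, w x = ∑ x, w x := by
      refine Finset.sum_subset (Finset.subset_univ _) fun x _ hx => ?_
      simpa [ht] using hx
    rw [h2] at h1
    refine le_trans ?_ h1
    have hz : ∀ s : Finset V, ¬ s ⊆ t → ∏ x ∈ s, w x = 0 := by
      intro s hs
      obtain ⟨x, hx, hxt⟩ := Finset.not_subset.mp hs
      exact Finset.prod_eq_zero hx (by simpa [ht] using hxt)
    have h3 : cliqueWeight G j w = ∑ s ∈ (cliquesOfCard G j).filter (· ⊆ t), ∏ x ∈ s, w x := by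
      rw [cliqueWeight, Finset.sum_filter]
      refine Finset.sum_congr rfl fun s _ => ?_
      split_ifs with hs
      · rfl
      · exact hz s hs
    rw [h3]
    refine Finset.sum_le_sum_of_subset_of_nonneg (fun s hs => ?_)
      fun s _ _ => Finset.prod_nonneg fun x _ => hw x
    rw [Finset.mem_filter, mem_cliquesOfCard] at hs
    exact Finset.mem_powersetCard.mpr ⟨hs.2, hs.1.1⟩
  · rw [SimpleGraph.IsClique, Set.Pairwise] at hcl
    push Not at hcl
    obtain ⟨u, hu, v, hv, huv, hadj⟩ := hcl
    simp only [Finset.coe_filter, Finset.mem_univ, true_and, Set.mem_ofPred_eq] at hu hv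
    obtain ⟨w', h1, h2, h3, h4, x, hx, hx'⟩ := exists_shift_weight G j w hw huv hadj hu hv
    refine h3.trans ?_
    rw [← h2]
    refine ih _ ?_ w' h1 rfl
    rw [← h]
    refine Finset.card_lt_card ?_
    rw [Finset.ssubset_iff_of_subset]
    · exact ⟨x, by simpa using hx, by simpa using hx'⟩
    · intro y hy
      simp only [Finset.mem_filter, Finset.mem_univ, true_and] at hy ⊢
      exact fun h => hy (h4 y h)

end WeightedCliques

/-! ### Growth of a monotone polynomial. -/

open Polynomial in
/-- A polynomial of degree at most `k` which increases from the value `0` on the unit interval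
increases by at least a fixed multiple of its leading coefficient. -/
theorem coeff_mul_factorial_le_of_monotoneOn {k : ℕ} (hk : k ≠ 0) (p : ℝ[X])
    (hdeg : p.natDegree ≤ k) (hmono : MonotoneOn (fun x => p.eval x) (Set.Icc 0 1))
    (h0 : p.eval 0 = 0) :
    p.coeff k * k.factorial ≤ (2 * k : ℝ) ^ k * p.eval 1 := by
  have h1 : 0 ≤ p.eval 1 := by
    have := hmono (by simp : (0 : ℝ) ∈ Set.Icc 0 1) (by simp : (1 : ℝ) ∈ Set.Icc 0 1) zero_le_one
    simpa [h0] using this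
  by_cases hc : p.coeff k = 0
  · rw [hc, zero_mul]; positivity
  have hkR : (0 : ℝ) < k := by positivity
  have hnd : p.natDegree = k := le_antisymm hdeg (le_natDegree_of_ne_zero hc)
  -- After rescaling, the `k`-th difference with unit step samples `p` at `0, 1/k, ..., 1`. It
  -- equals `k!` times the leading coefficient of `q`, and it is at most `2 ^ k * p(1)` because all
  -- samples lie in `[0, p(1)]`.
  set q : ℝ[X] := p.comp (C (1 / (k : ℝ)) * X) with hq
  have hlin : (C (1 / (k : ℝ)) * X).natDegree = 1 := natDegree_C_mul_X _ (by positivity)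
  have hqd : q.natDegree = k := by rw [hq, natDegree_comp, hlin, hnd, mul_one]
  have hql : q.leadingCoeff = p.coeff k * (1 / (k : ℝ)) ^ k := by
    rw [hq, leadingCoeff_comp (by rw [hlin]; exact one_ne_zero), leadingCoeff_C_mul_X, hnd,
      leadingCoeff, hnd]
  have hfd := congrFun (Polynomial.fwdDiff_iter_degree_eq_factorial q) 0
  rw [hqd, fwdDiff_iter_eq_sum_shift, hql] at hfd
  simp only [Pi.smul_apply, Pi.natCast_apply, smul_eq_mul] at hfd
  have hbound : ∑ i ∈ Finset.range (k + 1),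
      ((-1 : ℤ) ^ (k - i) * k.choose i) • q.eval (0 + i • (1 : ℝ)) ≤ 2 ^ k * p.eval 1 := by
    have : (2 : ℝ) ^ k = ∑ i ∈ Finset.range (k + 1), (k.choose i : ℝ) := by
      exact_mod_cast (Nat.sum_range_choose k).symm
    rw [this, Finset.sum_mul]
    refine Finset.sum_le_sum fun i hi => ?_
    have hi' : (i : ℝ) ≤ k := by
      exact_mod_cast Nat.lt_succ_iff.mp (Finset.mem_range.mp hi)
    have hx0 : 0 ≤ 1 / (k : ℝ) * i := by positivity
    have hx1 : 1 / (k : ℝ) * i ≤ 1 := by rw [one_div, inv_mul_le_iff₀ hkR]; simpa using hi'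
    have hqe : q.eval (0 + i • (1 : ℝ)) = p.eval (1 / (k : ℝ) * i) := by simp [hq]
    rw [hqe]
    have hp0 : 0 ≤ p.eval (1 / (k : ℝ) * i) := by
      have := hmono (by simp : (0 : ℝ) ∈ Set.Icc 0 1) ⟨hx0, hx1⟩ hx0
      simpa [h0] using this
    have hp1 : p.eval (1 / (k : ℝ) * i) ≤ p.eval 1 :=
      hmono ⟨hx0, hx1⟩ (by simp : (1 : ℝ) ∈ Set.Icc 0 1) hx1
    have hch : (0 : ℝ) ≤ k.choose i := Nat.cast_nonneg _
    rw [zsmul_eq_mul]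
    push_cast
    rcases neg_one_pow_eq_or ℝ (k - i) with h | h <;> rw [h] <;> nlinarith
  rw [hfd] at hbound
  have hkk : (0 : ℝ) < (k : ℝ) ^ k := by positivity
  have hmul := mul_le_mul_of_nonneg_right hbound hkk.le
  calc p.coeff k * k.factorial
      = p.coeff k * (1 / (k : ℝ)) ^ k * k.factorial * (k : ℝ) ^ k := by
        rw [one_div, inv_pow]; field_simp
    _ ≤ 2 ^ k * p.eval 1 * (k : ℝ) ^ k := hmul
    _ = _ := by rw [mul_pow]; ring

/-! ### Link shadows and the sparser bound inside one rank class. -/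

section Ranked

variable {V : Type*}

/-- The pairs covered by the link of `v`, where only the edges in which `v` has minimum rank are
taken into account. -/
def linkShadow (E : Finset (Finset V)) (rk : V → ℕ) (v : V) : SimpleGraph V where
  Adj x y := x ≠ y ∧ x ≠ v ∧ y ≠ v ∧
    ∃ e ∈ E, v ∈ e ∧ x ∈ e ∧ y ∈ e ∧ ∀ z ∈ e, rk v ≤ rk z
  symm := ⟨fun _ _ ⟨h1, h2, h3, e, he, h4, h5, h6, h7⟩ => ⟨h1.symm, h3, h2, e, he, h4, h6, h5, h7⟩⟩
  loopless := ⟨fun _ h => h.1 rfl⟩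

open scoped Classical in
theorem isClique_linkShadow_erase {E : Finset (Finset V)} {rk : V → ℕ} {v : V} {e : Finset V}
    (he : e ∈ E) (hv : v ∈ e) (hrk : ∀ z ∈ e, rk v ≤ rk z) :
    (linkShadow E rk v).IsClique (e.erase v : Finset V) := by
  intro x hx y hy hxy
  simp only [Finset.coe_erase, Set.mem_sdiff, Finset.mem_coe, Set.mem_singleton_iff] at hx hy
  exact ⟨hxy, hx.2, hy.2, e, he, hv, hx.1, hy.1, hrk⟩

variable [Fintype V]

section Inner

open scoped Classical

variable {r : ℕ} {E : Finset (Finset V)} {U : Finset V}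

/-- If `a ≠ b`, choose a third vertex `m` of `e`. In the link of `m`, the edge `e` covers the pairs
of `e \ {m}`, and the two exchanged edges cover the pairs of `x` with it: a clique on `r + 1`
vertices. -/
theorem eq_of_insert_erase_mem (hr : 2 ≤ r) (hcard : ∀ e ∈ E, e.card = r + 1)
    (hK : ∀ v, cliquesOfCard (linkShadow E (fun _ => 0) v) (r + 1) = ∅)
    {e : Finset V} (he : e ∈ E) {x a b : V} (ha : a ∈ e) (hb : b ∈ e)
    (hxa : x ∉ e.erase a) (hxb : x ∉ e.erase b)
    (hea : insert x (e.erase a) ∈ E) (heb : insert x (e.erase b) ∈ E) : a = b := by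
  by_contra hab
  have hx : x ∉ e := by
    intro hx
    simp only [Finset.mem_erase, not_and] at hxa hxb
    by_cases h : x = a
    · exact hab (h ▸ (by_contra fun h' => h' (by_contra fun h'' => hxb h'' hx)))
    · exact hxa h hx
  obtain ⟨m, hm, hma, hmb⟩ : ∃ m ∈ e, m ≠ a ∧ m ≠ b := by
    have : ((e.erase a).erase b).Nonempty := by
      rw [← Finset.card_pos, Finset.card_erase_of_mem (by simp [hb, Ne.symm hab]),
        Finset.card_erase_of_mem ha, hcard e he]
      omega
    obtain ⟨m, hm⟩ := this
    simp only [Finset.mem_erase] at hm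
    exact ⟨m, hm.2.2, hm.2.1, hm.1⟩
  have hxm : x ≠ m := fun h => hx (h ▸ hm)
  have hcl : insert x (e.erase m) ∈ cliquesOfCard (linkShadow E (fun _ => 0) m) (r + 1) := by
    rw [mem_cliquesOfCard]
    constructor
    · rw [Finset.card_insert_of_notMem (fun h => hx (Finset.mem_of_mem_erase h)),
        Finset.card_erase_of_mem hm, hcard e he]
      rfl
    · rw [Finset.coe_insert, SimpleGraph.isClique_insert_of_notMem
        (fun h => hx (Finset.mem_of_mem_erase h))]
      refine ⟨isClique_linkShadow_erase he hm (fun _ _ => le_rfl), fun y hy => ?_⟩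
      simp only [Finset.coe_erase, Set.mem_sdiff, Finset.mem_coe, Set.mem_singleton_iff] at hy
      have hxy : x ≠ y := fun h => hx (h ▸ hy.1)
      by_cases hya : y = a
      · refine ⟨hxy, hxm, hy.2, _, heb, ?_, by simp, ?_, fun _ _ => le_rfl⟩
        · simp [hm, hmb]
        · simp [hya, ha, hab]
      · refine ⟨hxy, hxm, hy.2, _, hea, ?_, by simp, ?_, fun _ _ => le_rfl⟩
        · simp [hm, hma]
        · simp [hya, hy.1]
  simp [hK m] at hcl

/-- Cauchy–Schwarz for the degrees of the `r`-sets in the shadow. The sum of squares counts pairs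
`(e, a)`, `(e', x)` with `e \ {a} = e' \ {x}`; by `eq_of_insert_erase_mem` such a pair is determined
by `e` and `x`. -/
theorem sum_sq_card_fiber_le (hr : 2 ≤ r) (hcard : ∀ e ∈ E, e.card = r + 1)
    (hU : ∀ e ∈ E, e ⊆ U)
    (hK : ∀ v, cliquesOfCard (linkShadow E (fun _ => 0) v) (r + 1) = ∅) :
    (((r + 1) * E.card) ^ 2 : ℝ) ≤ E.shadow.card * (E.card * U.card) := by
  set D : Finset (Σ _ : Finset V, V) := E.sigma fun e => e with hD
  set f : (Σ _ : Finset V, V) → Finset V := fun p => p.1.erase p.2 with hf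
  have hmaps : ∀ p ∈ D, f p ∈ E.shadow := by
    intro p hp
    obtain ⟨h1, h2⟩ := Finset.mem_sigma.mp hp
    exact Finset.mem_shadow_iff.mpr ⟨p.1, h1, p.2, h2, rfl⟩
  have hDcard : D.card = (r + 1) * E.card := by
    rw [hD, Finset.card_sigma, Finset.sum_congr rfl hcard]
    simp [mul_comm]
  have hsum : D.card = ∑ q ∈ E.shadow, (D.filter fun p => f p = q).card :=
    Finset.card_eq_sum_card_fiberwise hmaps
  have hsq : ∑ q ∈ E.shadow, (D.filter fun p => f p = q).card ^ 2
      = ∑ p ∈ D, (D.filter fun p' => f p' = f p).card := by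
    rw [← Finset.sum_fiberwise_of_maps_to hmaps]
    refine Finset.sum_congr rfl fun q _ => ?_
    rw [Finset.sum_congr rfl (g := fun _ => (D.filter fun p => f p = q).card)]
    · simp [sq]
    · intro p hp
      rw [(Finset.mem_filter.mp hp).2]
  have hle : ∑ p ∈ D, (D.filter fun p' => f p' = f p).card ≤ E.card * U.card := by
    rw [← Finset.card_sigma, ← Finset.card_product]
    refine Finset.card_le_card_of_injOn (fun t => (t.1.1, t.2.2)) ?_ ?_
    · rintro ⟨p, p'⟩ ht
      simp only [Finset.coe_sigma, Set.mem_sigma_iff, Finset.mem_coe, Finset.mem_filter, hD,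
        Finset.mem_sigma] at ht
      simp only [Finset.coe_product, Set.mem_prod, Finset.mem_coe]
      exact ⟨ht.1.1, hU _ ht.2.1.1 ht.2.1.2⟩
    · rintro ⟨⟨e, a⟩, ⟨e', x⟩⟩ ht ⟨⟨e₂, b⟩, ⟨e₂', x₂⟩⟩ ht₂ heq
      simp only [Finset.coe_sigma, Set.mem_sigma_iff, Finset.mem_coe, Finset.mem_filter, hD,
        Finset.mem_sigma, hf] at ht ht₂
      simp only [Prod.mk.injEq] at heq
      obtain ⟨rfl, rfl⟩ := heq
      have i1 : insert x (e.erase a) = e' := by rw [← ht.2.2, Finset.insert_erase ht.2.1.2]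
      have i2 : insert x (e.erase b) = e₂' := by rw [← ht₂.2.2, Finset.insert_erase ht₂.2.1.2]
      have n1 : x ∉ e.erase a := by rw [← ht.2.2]; exact Finset.notMem_erase _ _
      have n2 : x ∉ e.erase b := by rw [← ht₂.2.2]; exact Finset.notMem_erase _ _
      have hab : a = b := eq_of_insert_erase_mem hr hcard hK ht.1.1 ht.1.2 ht₂.1.2 n1 n2
        (by rw [i1]; exact ht.2.1.1) (by rw [i2]; exact ht₂.2.1.1)
      subst hab
      rw [← i1, ← i2]
  have hcs := sq_sum_le_card_mul_sum_sq (s := E.shadow)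
    (f := fun q => (((D.filter fun p => f p = q).card : ℕ) : ℝ))
  have e1 : (∑ q ∈ E.shadow, (((D.filter fun p => f p = q).card : ℕ) : ℝ)) = (r + 1) * E.card := by
    rw [← Nat.cast_sum, ← hsum, hDcard]; push_cast; ring
  rw [e1] at hcs
  refine hcs.trans (mul_le_mul_of_nonneg_left ?_ (Nat.cast_nonneg _))
  exact_mod_cast hsq.trans_le hle

/-- Removing `v` from a shadow set through `v` leaves an `(r - 1)`-clique of the link shadow of `v`.
Zykov bounds their number, and summing over `v` counts each shadow set `r` times. -/
theorem card_shadow_le (hr : 2 ≤ r) (hcard : ∀ e ∈ E, e.card = r + 1)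
    (hU : ∀ e ∈ E, e ⊆ U)
    (hK : ∀ v, cliquesOfCard (linkShadow E (fun _ => 0) v) (r + 1) = ∅) :
    (E.shadow.card : ℝ) ≤ U.card * (U.card / r) ^ (r - 1) := by
  have hmem : ∀ q ∈ E.shadow, q.card = r ∧ ∃ e ∈ E, q ⊆ e := by
    intro q hq
    obtain ⟨e, he, a, ha, rfl⟩ := Finset.mem_shadow_iff.mp hq
    refine ⟨?_, e, he, Finset.erase_subset _ _⟩
    rw [Finset.card_erase_of_mem ha, hcard e he]
    rfl
  have hdeg : ∀ v ∈ U, ((E.shadow.filter fun q => v ∈ q).card : ℝ)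
      ≤ r * ((U.card : ℝ) / r) ^ (r - 1) := by
    intro v _
    have hw := cliqueWeight_le (linkShadow E (fun _ => 0) v) (hK v) (r - 1)
      (fun x => if x ∈ U then (1 : ℝ) else 0) (fun x => by positivity)
    have hch : r.choose (r - 1) = r := by
      obtain ⟨s, rfl⟩ : ∃ s, r = s + 1 := ⟨r - 1, by omega⟩
      simp
    rw [hch] at hw
    simp only [Finset.sum_ite_mem, Finset.univ_inter, Finset.sum_const, nsmul_eq_mul,
      mul_one] at hw
    refine le_trans ?_ hw
    rw [cliqueWeight, Finset.card_eq_sum_ones, Nat.cast_sum]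
    have hinj : Set.InjOn (fun q : Finset V => q.erase v) (E.shadow.filter fun q => v ∈ q) := by
      intro q hq q' hq' h
      simp only [Finset.coe_filter, Set.mem_ofPred_eq] at hq hq'
      rw [← Finset.insert_erase hq.2, ← Finset.insert_erase hq'.2]
      exact congrArg (insert v) h
    calc ∑ q ∈ E.shadow.filter fun q => v ∈ q, ((1 : ℕ) : ℝ)
        = ∑ s ∈ (E.shadow.filter fun q => v ∈ q).image fun q => q.erase v,
            ∏ x ∈ s, (if x ∈ U then (1 : ℝ) else 0) := by
          rw [Finset.sum_image hinj]
          refine Finset.sum_congr rfl fun q hq => ?_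
          obtain ⟨-, e, he, hqe⟩ := hmem q (Finset.mem_filter.mp hq).1
          rw [Finset.prod_eq_one]
          · simp
          · intro x hx
            rw [if_pos (hU e he (hqe (Finset.mem_of_mem_erase hx)))]
      _ ≤ _ := by
          refine Finset.sum_le_sum_of_subset_of_nonneg ?_ fun s _ _ =>
            Finset.prod_nonneg fun x _ => by positivity
          intro s hs
          obtain ⟨q, hq, rfl⟩ := Finset.mem_image.mp hs
          rw [Finset.mem_filter] at hq
          obtain ⟨hqr, e, he, hqe⟩ := hmem q hq.1
          rw [mem_cliquesOfCard, Finset.card_erase_of_mem hq.2, hqr]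
          refine ⟨rfl, (isClique_linkShadow_erase he (hqe hq.2) fun _ _ => le_rfl).subset ?_⟩
          exact Finset.coe_subset.mpr (Finset.erase_subset_erase _ hqe)
  have hdc : (r : ℝ) * E.shadow.card
      = ∑ v ∈ U, ((E.shadow.filter fun q => v ∈ q).card : ℝ) := by
    have : ∑ q ∈ E.shadow, (U.filter fun v => v ∈ q).card
        = ∑ v ∈ U, (E.shadow.filter fun q => v ∈ q).card :=
      Finset.sum_card_bipartiteAbove_eq_sum_card_bipartiteBelow (fun q v => v ∈ q)
    rw [← Nat.cast_sum, ← this, Finset.sum_congr rfl (g := fun _ => r)]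
    · simp [mul_comm]
    · intro q hq
      obtain ⟨hqr, e, he, hqe⟩ := hmem q hq
      rw [← hqr]
      congr 1
      ext x
      simpa using fun hx => hU e he (hqe hx)
  have hsum := Finset.sum_le_sum hdeg
  rw [← hdc, Finset.sum_const, nsmul_eq_mul] at hsum
  have hr0 : (0 : ℝ) < r := by positivity
  nlinarith [hsum]

/-- A `(r + 1)`-graph none of whose links covers all the pairs of an `(r + 1)`-set is sparser than
the extremal such `r`-graphs. -/
theorem card_mul_le_of_linkShadow (hr : 2 ≤ r) (hcard : ∀ e ∈ E, e.card = r + 1)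
    (hU : ∀ e ∈ E, e ⊆ U)
    (hK : ∀ v, cliquesOfCard (linkShadow E (fun _ => 0) v) (r + 1) = ∅) :
    ((r + 1) ^ 2 * E.card : ℝ) ≤ U.card ^ 2 * (U.card / r) ^ (r - 1) := by
  have h1 := sum_sq_card_fiber_le hr hcard hU hK
  have h2 := card_shadow_le hr hcard hU hK
  rcases Nat.eq_zero_or_pos E.card with h0 | hpos
  · rw [h0]; push_cast; rw [mul_zero]; positivity
  have hE : (0 : ℝ) < E.card := by exact_mod_cast hpos
  have h3 : (E.shadow.card : ℝ) * (E.card * U.card)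
      ≤ U.card * (U.card / r) ^ (r - 1) * (E.card * U.card) :=
    mul_le_mul_of_nonneg_right h2 (by positivity)
  have h4 := h1.trans h3
  refine le_of_mul_le_mul_right ?_ hE
  calc _ = (((r + 1) * E.card) ^ 2 : ℝ) := by ring
    _ ≤ _ := h4
    _ = _ := by ring

end Inner

end Ranked

/-! ### Strict density bound for ranked hypergraphs. -/

section RankedBound

open scoped Classical

variable {V : Type*} [Fintype V] {r : ℕ} {E : Finset (Finset V)} {rk : V → ℕ}

/-- The edges of minimum rank `j`. -/
noncomputable def edgesOfRank (E : Finset (Finset V)) (rk : V → ℕ) (j : ℕ) : Finset (Finset V) :=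
  E.filter fun e => (∀ z ∈ e, j ≤ rk z) ∧ ∃ z ∈ e, rk z = j

/-- The left side is the derivative in `θ` of the total edge weight when vertices of rank `j` weigh
`θ` and those of higher rank weigh `1`. Differentiating removes one vertex of rank `j`, and Zykov
bounds what remains in its link. -/
theorem sum_deriv_edgesOfRank_le (hcard : ∀ e ∈ E, e.card = r + 1)
    (hK : ∀ v, cliquesOfCard (linkShadow E rk v) (r + 1) = ∅) (j : ℕ) {θ : ℝ} (hθ : 0 ≤ θ) :
    ∑ e ∈ edgesOfRank E rk j,
        ((e.filter fun x => rk x = j).card : ℝ) * θ ^ ((e.filter fun x => rk x = j).card - 1)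
      ≤ (Finset.univ.filter fun x => rk x = j).card *
        ((θ * (Finset.univ.filter fun x => rk x = j).card
          + (Finset.univ.filter fun x => j + 1 ≤ rk x).card) / r) ^ r := by
  set w : V → ℝ := fun x => if rk x = j then θ else if j + 1 ≤ rk x then 1 else 0 with hw
  have hw0 : ∀ x, 0 ≤ w x := fun x => by simp only [hw]; split_ifs <;> positivity
  have hwsum : ∑ x, w x = θ * (Finset.univ.filter fun x => rk x = j).card
      + (Finset.univ.filter fun x => j + 1 ≤ rk x).card := by
    have : ∀ x, w x = (if rk x = j then θ else 0) + (if j + 1 ≤ rk x then 1 else 0) := by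
      intro x
      simp only [hw]
      split_ifs with h1 h2 <;> simp
      omega
    simp only [this]
    rw [Finset.sum_add_distrib, ← Finset.sum_filter, ← Finset.sum_filter]
    simp [mul_comm]
  have hterm : ∀ e ∈ edgesOfRank E rk j,
      ((e.filter fun x => rk x = j).card : ℝ) * θ ^ ((e.filter fun x => rk x = j).card - 1)
        = ∑ v ∈ e.filter (fun x => rk x = j), ∏ x ∈ e.erase v, w x := by
    intro e he
    rw [edgesOfRank, Finset.mem_filter] at he
    rw [Finset.sum_congr rfl
      (g := fun _ => θ ^ ((e.filter fun x => rk x = j).card - 1))]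
    · simp
    · intro v hv
      have h1 : ∏ x ∈ e.erase v, w x = ∏ x ∈ e.erase v, if rk x = j then θ else 1 := by
        refine Finset.prod_congr rfl fun x hx => ?_
        have := he.2.1 x (Finset.mem_of_mem_erase hx)
        simp only [hw]
        split_ifs with h1 h2
        · rfl
        · rfl
        · omega
      rw [h1, ← Finset.prod_filter, Finset.prod_const, Finset.filter_erase,
        Finset.card_erase_of_mem hv]
  rw [Finset.sum_congr rfl hterm]
  rw [Finset.sum_comm' (t' := Finset.univ.filter fun x => rk x = j)
    (s' := fun v => (edgesOfRank E rk j).filter fun e => v ∈ e)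
    (by intro e v; simp only [Finset.mem_filter, Finset.mem_univ, true_and]; tauto)]
  rw [← hwsum, ← nsmul_eq_mul]
  refine Finset.sum_le_card_nsmul _ _ _ fun v hv => ?_
  have hvj : rk v = j := (Finset.mem_filter.mp hv).2
  have hcl := cliqueWeight_le (linkShadow E rk v) (hK v) r w hw0
  rw [Nat.choose_self, Nat.cast_one, one_mul] at hcl
  refine le_trans ?_ hcl
  have hinj : Set.InjOn (fun q : Finset V => q.erase v)
      ((edgesOfRank E rk j).filter fun e => v ∈ e) := by
    intro q hq q' hq' h
    simp only [Finset.coe_filter, Set.mem_ofPred_eq] at hq hq'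
    rw [← Finset.insert_erase hq.2, ← Finset.insert_erase hq'.2]
    exact congrArg (insert v) h
  rw [← Finset.sum_image (f := fun s => ∏ x ∈ s, w x) hinj, cliqueWeight]
  refine Finset.sum_le_sum_of_subset_of_nonneg ?_ fun s _ _ =>
    Finset.prod_nonneg fun x _ => hw0 x
  intro s hs
  obtain ⟨e, he, rfl⟩ := Finset.mem_image.mp hs
  rw [Finset.mem_filter, edgesOfRank, Finset.mem_filter] at he
  rw [mem_cliquesOfCard, Finset.card_erase_of_mem he.2, hcard e he.1.1]
  refine ⟨rfl, isClique_linkShadow_erase he.1.1 he.2 ?_⟩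
  rw [hvj]
  exact he.1.2.1

theorem linkShadow_le_of_subset {V : Type*} {E : Finset (Finset V)} {rk : V → ℕ}
    {E' : Finset (Finset V)} (h : E' ⊆ E)
    {rk' : V → ℕ} (hrk : ∀ e ∈ E', ∀ v ∈ e, ∀ z ∈ e, rk v ≤ rk z) (v : V) :
    linkShadow E' rk' v ≤ linkShadow E rk v := by
  rintro x y ⟨h1, h2, h3, e, he, h4, h5, h6, -⟩
  exact ⟨h1, h2, h3, e, h he, h4, h5, h6, hrk e he v h4⟩

/-- Inside one rank class the minimality condition in `linkShadow` is vacuous, so the unranked bound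
applies. -/
theorem card_edges_of_constant_rank_le (hr : 2 ≤ r) (hcard : ∀ e ∈ E, e.card = r + 1)
    (hK : ∀ v, cliquesOfCard (linkShadow E rk v) (r + 1) = ∅) (j : ℕ) :
    ((r + 1) ^ 2 * (E.filter fun e => ∀ z ∈ e, rk z = j).card : ℝ)
      ≤ ((Finset.univ.filter fun x => rk x = j).card : ℝ) ^ 2 *
        ((Finset.univ.filter fun x => rk x = j).card / r) ^ (r - 1) := by
  refine card_mul_le_of_linkShadow hr (fun e he => hcard e (Finset.mem_filter.mp he).1) ?_ ?_
  · intro e he x hx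
    simpa using (Finset.mem_filter.mp he).2 x hx
  · intro v
    rw [Finset.eq_empty_iff_forall_notMem]
    intro s hs
    rw [mem_cliquesOfCard] at hs
    have : s ∈ cliquesOfCard (linkShadow E rk v) (r + 1) := by
      rw [mem_cliquesOfCard]
      refine ⟨hs.1, hs.2.mono (linkShadow_le_of_subset (Finset.filter_subset _ _) ?_ v)⟩
      intro e he a ha z hz
      have := (Finset.mem_filter.mp he).2
      rw [this a ha, this z hz]
    simp [hK v] at this

-- The polynomial `p` below measures the slack in the edge bound as the weight of the rank class
-- grows from `0` to `1`. Zykov makes it monotone, so `p(1) ≥ 0` already gives the first term; its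
-- positive leading coefficient gives the loss.
open Polynomial in
theorem card_edgesOfRank_le (hr : 2 ≤ r) (hcard : ∀ e ∈ E, e.card = r + 1)
    (hK : ∀ v, cliquesOfCard (linkShadow E rk v) (r + 1) = ∅) (j : ℕ) :
    ((edgesOfRank E rk j).card : ℝ)
      ≤ 1 / ((r + 1) * r ^ r) * (((Finset.univ.filter fun x => j ≤ rk x).card : ℝ) ^ (r + 1)
          - ((Finset.univ.filter fun x => j + 1 ≤ rk x).card : ℝ) ^ (r + 1))
        - (r + 1).factorial / ((2 * (r + 1)) ^ (r + 1) * ((r + 1) ^ 2 * r ^ r)) *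
          ((Finset.univ.filter fun x => rk x = j).card : ℝ) ^ (r + 1) := by
  set u : ℝ := ((Finset.univ.filter fun x => rk x = j).card : ℝ) with hu
  set ρ : ℝ := ((Finset.univ.filter fun x => j + 1 ≤ rk x).card : ℝ) with hρ
  have hs : ((Finset.univ.filter fun x => j ≤ rk x).card : ℝ) = u + ρ := by
    rw [hu, hρ, ← Nat.cast_add, ← Finset.card_union_of_disjoint]
    · congr 2
      ext x
      simp only [Finset.mem_filter, Finset.mem_univ, true_and, Finset.mem_union]
      omega
    · rw [Finset.disjoint_filter]
      intro x _ h
      omega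
  rw [hs]
  have hr0 : (0 : ℝ) < r := by
    have : 0 < r := by omega
    exact_mod_cast this
  set i : Finset V → ℕ := fun e => (e.filter fun x => rk x = j).card with hi
  set p : ℝ[X] := C (1 / ((r + 1) * r ^ r : ℝ)) * ((C u * X + C ρ) ^ (r + 1) - C (ρ ^ (r + 1)))
    - ∑ e ∈ edgesOfRank E rk j, X ^ i e with hp
  have hile : ∀ e ∈ edgesOfRank E rk j, 1 ≤ i e ∧ i e ≤ r + 1 := by
    intro e he
    rw [edgesOfRank, Finset.mem_filter] at he
    refine ⟨?_, (Finset.card_filter_le _ _).trans (hcard e he.1).le⟩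
    obtain ⟨z, hz, hzj⟩ := he.2.2
    exact Finset.card_pos.mpr ⟨z, Finset.mem_filter.mpr ⟨hz, hzj⟩⟩
  have hlin : (C u * X + C ρ).natDegree ≤ 1 := natDegree_linear_le
  have hpow : ((C u * X + C ρ) ^ (r + 1)).natDegree ≤ r + 1 :=
    natDegree_pow_le_of_le (r + 1) hlin |>.trans (by simp)
  have hdeg : p.natDegree ≤ r + 1 := by
    refine (natDegree_sub_le _ _).trans (max_le ?_ ?_)
    · refine (natDegree_C_mul_le _ _).trans ((natDegree_sub_le _ _).trans (max_le hpow ?_))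
      simp
    · refine natDegree_sum_le_of_forall_le _ _ fun e he => ?_
      rw [natDegree_X_pow]
      exact (hile e he).2
  have h0 : p.eval 0 = 0 := by
    simp only [hp, eval_sub, eval_mul, eval_C, eval_pow, eval_add, eval_X, mul_zero, zero_add,
      sub_self, eval_finsetSum]
    rw [Finset.sum_eq_zero, sub_zero]
    intro e he
    exact zero_pow (by have := (hile e he).1; omega)
  have hmono : MonotoneOn (fun x => p.eval x) (Set.Icc 0 1) := by
    refine monotoneOn_of_deriv_nonneg (convex_Icc 0 1) p.continuous.continuousOn
      p.differentiable.differentiableOn fun x hx => ?_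
    rw [interior_Icc] at hx
    have hd := sum_deriv_edgesOfRank_le hcard hK j hx.1.le
    rw [Polynomial.deriv]
    have : p.derivative.eval x = u * ((x * u + ρ) / r) ^ r
        - ∑ e ∈ edgesOfRank E rk j, (i e : ℝ) * x ^ (i e - 1) := by
      simp only [hp, derivative_sub, derivative_mul, derivative_C, derivative_pow, derivative_add,
        derivative_X, derivative_sum, eval_sub, eval_mul, eval_C, eval_pow, eval_add, eval_X,
        eval_finsetSum, zero_mul, zero_add, mul_one, add_zero, sub_zero,
        Nat.add_sub_cancel]
      congr 1
      rw [div_pow]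
      push_cast
      field_simp
    rw [this]
    linarith
  have key := coeff_mul_factorial_le_of_monotoneOn (Nat.succ_ne_zero r) p hdeg hmono h0
  have h1 : p.eval 1 = 1 / ((r + 1) * r ^ r) * ((u + ρ) ^ (r + 1) - ρ ^ (r + 1))
      - (edgesOfRank E rk j).card := by
    simp [hp, eval_finsetSum]
  -- Only edges with all `r + 1` vertices of rank `j` contribute to the top degree.
  have hcoeff : p.coeff (r + 1) = 1 / ((r + 1) * r ^ r) * u ^ (r + 1)
      - ((E.filter fun e => ∀ z ∈ e, rk z = j).card : ℝ) := by
    have hc1 : ((C u * X + C ρ) ^ (r + 1)).coeff (r + 1) = u ^ (r + 1) := by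
      have := coeff_pow_of_natDegree_le hlin (m := r + 1)
      simpa using this
    have hc2 : (∑ e ∈ edgesOfRank E rk j, (X : ℝ[X]) ^ i e).coeff (r + 1)
        = ((E.filter fun e => ∀ z ∈ e, rk z = j).card : ℝ) := by
      rw [finsetSum_coeff]
      simp only [coeff_X_pow]
      rw [← Finset.sum_filter, Finset.sum_const, nsmul_eq_mul, mul_one]
      congr 2
      ext e
      simp only [Finset.mem_filter, edgesOfRank]
      constructor
      · rintro ⟨⟨he, h2, h3⟩, h4⟩
        refine ⟨he, fun z hz => ?_⟩
        have : e.filter (fun x => rk x = j) = e :=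
          Finset.eq_of_subset_of_card_le (Finset.filter_subset _ _) (by
            rw [hcard e he]; exact h4.le)
        rw [← this] at hz
        exact (Finset.mem_filter.mp hz).2
      · rintro ⟨he, h2⟩
        have hne : e.Nonempty := by rw [← Finset.card_pos, hcard e he]; omega
        obtain ⟨z, hz⟩ := hne
        refine ⟨⟨he, fun z hz => (h2 z hz).ge, z, hz, h2 z hz⟩, ?_⟩
        simp only [hi]
        rw [Finset.filter_true_of_mem h2, hcard e he]
    rw [hp, coeff_sub, coeff_C_mul, coeff_sub, hc1, hc2, coeff_C]
    simp
  rw [h1] at key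
  have hin := card_edges_of_constant_rank_le hr hcard hK j
  rw [← hu] at hin
  set N : ℝ := ((E.filter fun e => ∀ z ∈ e, rk z = j).card : ℝ)
  have hrr : u ^ 2 * (u / r) ^ (r - 1) = r / r ^ r * u ^ (r + 1) := by
    obtain ⟨s, rfl⟩ : ∃ s, r = s + 1 := ⟨r - 1, by omega⟩
    rw [Nat.add_sub_cancel, div_pow]
    field_simp
    ring
  rw [hrr] at hin
  -- The surplus is `1 / (r + 1) - r / (r + 1) ^ 2 = 1 / (r + 1) ^ 2`, up to the common factor `u ^
  -- (r + 1) / r ^ r`.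
  have hlow : 1 / ((r + 1) ^ 2 * r ^ r) * u ^ (r + 1) ≤ p.coeff (r + 1) := by
    rw [hcoeff]
    have hN : N ≤ (r / r ^ r * u ^ (r + 1)) / (r + 1) ^ 2 := by
      rw [le_div_iff₀ (by positivity)]
      linarith
    have : 1 / ((r + 1) * r ^ r) * u ^ (r + 1) - (r / r ^ r * u ^ (r + 1)) / (r + 1) ^ 2
        = 1 / ((r + 1) ^ 2 * r ^ r) * u ^ (r + 1) := by
      field_simp
      ring
    linarith
  have hfac : (0 : ℝ) < (r + 1).factorial := by exact_mod_cast Nat.factorial_pos _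
  have key2 := (mul_le_mul_of_nonneg_right hlow hfac.le).trans key
  push_cast at key2
  have hpos : (0 : ℝ) < (2 * (r + 1)) ^ (r + 1) := by positivity
  rw [← div_le_iff₀' hpos] at key2
  have e : 1 / ((r + 1) ^ 2 * r ^ r) * u ^ (r + 1) * ((r + 1).factorial : ℝ)
      / (2 * (r + 1)) ^ (r + 1)
      = (r + 1).factorial / ((2 * (r + 1)) ^ (r + 1) * ((r + 1) ^ 2 * r ^ r)) * u ^ (r + 1) := by
    field_simp
  rw [e] at key2
  linarith

/-- If the vertices of an `(r + 1)`-graph have ranks less than `D` and no link, restricted to the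
vertices of at least the same rank, covers all the pairs of an `(r + 1)`-set, then the density of
the graph is bounded away from `r! / r ^ r`. -/
theorem exists_card_le_of_ranked (hr : 2 ≤ r) {D : ℕ} (hD : 0 < D) :
    ∃ c : ℝ, 0 < c ∧ ∀ (V : Type) [Fintype V] (E : Finset (Finset V)) (rk : V → ℕ),
      (∀ e ∈ E, e.card = r + 1) → (∀ v, rk v < D) →
      (∀ v, cliquesOfCard (linkShadow E rk v) (r + 1) = ∅) →
      (E.card : ℝ) ≤ (1 / ((r + 1) * r ^ r) - c) * (Fintype.card V : ℝ) ^ (r + 1) := by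
  have hr0 : (0 : ℝ) < r := by
    have : 0 < r := by omega
    exact_mod_cast this
  have hfac : (0 : ℝ) < (r + 1).factorial := by exact_mod_cast Nat.factorial_pos _
  have hDR : (0 : ℝ) < D := by exact_mod_cast hD
  set a : ℝ := (r + 1).factorial / ((2 * (r + 1)) ^ (r + 1) * ((r + 1) ^ 2 * r ^ r)) with ha
  have ha0 : 0 < a := by positivity
  refine ⟨a / D ^ (r + 1), by positivity, ?_⟩
  intro V _ E rk hcard hrk hK
  set s : ℕ → ℝ := fun j => ((Finset.univ.filter fun x => j ≤ rk x).card : ℝ) with hs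
  set u : ℕ → ℝ := fun j => ((Finset.univ.filter fun x => rk x = j).card : ℝ) with hu
  have hEsum : (E.card : ℝ) ≤ ∑ j ∈ Finset.range D, ((edgesOfRank E rk j).card : ℝ) := by
    rw [← Nat.cast_sum]
    refine Nat.cast_le.mpr (le_trans (Finset.card_le_card ?_) Finset.card_biUnion_le)
    intro e he
    have hne : e.Nonempty := by rw [← Finset.card_pos, hcard e he]; omega
    obtain ⟨z, hz, hmin⟩ := e.exists_min_image rk hne
    exact Finset.mem_biUnion.mpr ⟨rk z, Finset.mem_range.mpr (hrk z),
      Finset.mem_filter.mpr ⟨he, hmin, z, hz, rfl⟩⟩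
  have hle : ∑ j ∈ Finset.range D, ((edgesOfRank E rk j).card : ℝ)
      ≤ 1 / ((r + 1) * r ^ r) * (s 0 ^ (r + 1) - s D ^ (r + 1))
        - a * ∑ j ∈ Finset.range D, u j ^ (r + 1) := by
    -- The main terms telescope over the ranks; only the losses add up.
    rw [← Finset.sum_range_sub' (fun j => s j ^ (r + 1)), Finset.mul_sum, Finset.mul_sum,
      ← Finset.sum_sub_distrib]
    exact Finset.sum_le_sum fun j _ => card_edgesOfRank_le hr hcard hK j
  have hs0 : s 0 = Fintype.card V := by simp [hs, Finset.card_univ]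
  have hsD : 0 ≤ s D ^ (r + 1) := by positivity
  have husum : ∑ j ∈ Finset.range D, u j = Fintype.card V := by
    rw [← Nat.cast_sum, ← Finset.card_univ,
      Finset.card_eq_sum_card_fiberwise (f := rk) (t := Finset.range D)]
    intro x _
    simpa using hrk x
  obtain ⟨j, hj, hju⟩ : ∃ j ∈ Finset.range D, (Fintype.card V : ℝ) / D ≤ u j := by
    refine Finset.exists_le_of_sum_le ⟨0, Finset.mem_range.mpr hD⟩ ?_
    rw [husum, Finset.sum_const, Finset.card_range, nsmul_eq_mul]
    exact le_of_eq (by field_simp)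
  have hmax : ((Fintype.card V : ℝ) / D) ^ (r + 1) ≤ ∑ j ∈ Finset.range D, u j ^ (r + 1) :=
    (pow_le_pow_left₀ (by positivity) hju _).trans
      (Finset.single_le_sum (f := fun j => u j ^ (r + 1)) (fun j _ => by positivity) hj)
  have h1 : (0 : ℝ) ≤ 1 / ((r + 1) * r ^ r) * s D ^ (r + 1) := by positivity
  have h2 := mul_le_mul_of_nonneg_left hmax ha0.le
  rw [div_pow] at h2
  rw [hs0] at hle
  calc (E.card : ℝ) ≤ _ := hEsum.trans hle
    _ ≤ 1 / ((r + 1) * r ^ r) * (Fintype.card V : ℝ) ^ (r + 1)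
        - a * ((Fintype.card V : ℝ) ^ (r + 1) / D ^ (r + 1)) := by linarith
    _ = _ := by ring

end RankedBound

/-! ### Trees of cones and robust roots. -/

section ConeTree

open scoped Classical

/-- The vertices of the tree of cones of depth `d`: the root and, for every vertex of the base `A`
of its cone, the vertices of a tree of depth `d - 1`. -/
def ConeTreeVert (A : Type) : ℕ → Type
  | 0 => Unit
  | d + 1 => Option (A × ConeTreeVert A d)

instance ConeTreeVert.finite (A : Type) [Finite A] : ∀ d, Finite (ConeTreeVert A d)
  | 0 => inferInstanceAs (Finite Unit)
  | d + 1 =>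
    have := ConeTreeVert.finite A d
    inferInstanceAs (Finite (Option (A × ConeTreeVert A d)))

/-- The root of the tree of cones. -/
def coneTreeRoot (A : Type) : ∀ d, ConeTreeVert A d
  | 0 => ()
  | d + 1 => (none : Option (A × ConeTreeVert A d))

/-- The inclusion of the branch of the tree at the vertex `a` of the base of the first cone. -/
def coneTreeBranch {A : Type} (d : ℕ) (a : A) : ConeTreeVert A d ↪ ConeTreeVert A (d + 1) :=
  ⟨fun x => (some (a, x) : Option (A × ConeTreeVert A d)), fun x y h => by
    have : (a, x) = (a, y) := Option.some_injective _ h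
    exact (Prod.mk.inj this).2⟩

/-- The inclusion of the base of the first cone. -/
def coneTreeBase {A : Type} (d : ℕ) : A ↪ ConeTreeVert A (d + 1) :=
  ⟨fun a => coneTreeBranch d a (coneTreeRoot A d), fun a b h => by
    have : (a, coneTreeRoot A d) = (b, coneTreeRoot A d) := Option.some_injective _ h
    exact (Prod.mk.inj this).1⟩

theorem coneTreeBranch_ne_root {A : Type} {d : ℕ} (a : A) (x : ConeTreeVert A d) :
    coneTreeBranch d a x ≠ coneTreeRoot A (d + 1) :=
  Option.some_ne_none (a, x)

theorem coneTreeVert_succ_cases {A : Type} {d : ℕ} (x : ConeTreeVert A (d + 1)) :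
    x = coneTreeRoot A (d + 1) ∨ ∃ a y, x = coneTreeBranch d a y := by
  rcases x with _ | ⟨a, y⟩
  · exact Or.inl rfl
  · exact Or.inr ⟨a, y, rfl⟩

/-- The edges of the tree of cones over the hypergraph with edge set `X`. -/
noncomputable def coneTreeEdges {A : Type} [Fintype A] (X : Finset (Finset A)) :
    ∀ d, Finset (Finset (ConeTreeVert A d))
  | 0 => ∅
  | d + 1 => (X.image fun f => insert (coneTreeRoot A (d + 1)) (f.map (coneTreeBase d))) ∪
      Finset.univ.biUnion fun a => (coneTreeEdges X d).image fun e => e.map (coneTreeBranch d a)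

variable {A : Type} [Fintype A] {X : Finset (Finset A)}

theorem mem_coneTreeEdges_succ {d : ℕ} {e : Finset (ConeTreeVert A (d + 1))} :
    e ∈ coneTreeEdges X (d + 1) ↔
      (∃ f ∈ X, insert (coneTreeRoot A (d + 1)) (f.map (coneTreeBase d)) = e) ∨
      ∃ a, ∃ e' ∈ coneTreeEdges X d, e'.map (coneTreeBranch d a) = e := by
  simp [coneTreeEdges]

theorem card_of_mem_coneTreeEdges {r : ℕ} (hX : ∀ f ∈ X, f.card = r) :
    ∀ d, ∀ e ∈ coneTreeEdges X d, e.card = r + 1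
  | 0 => by simp [coneTreeEdges]
  | d + 1 => by
    intro e he
    rcases mem_coneTreeEdges_succ.mp he with ⟨f, hf, rfl⟩ | ⟨a, e', he', rfl⟩
    · rw [Finset.card_insert_of_notMem, Finset.card_map, hX f hf]
      intro h
      obtain ⟨a, -, ha⟩ := Finset.mem_map.mp h
      exact coneTreeBranch_ne_root a _ ha
    · rw [Finset.card_map]
      exact card_of_mem_coneTreeEdges hX d e' he'

/-- The tree of cones of depth `d` over an `r`-graph, as an `(r + 1)`-graph. -/
noncomputable def coneTree {r : ℕ} (X : Finset (Finset A)) (hX : ∀ f ∈ X, f.card = r) (d : ℕ) :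
    KGraph (r + 1) (ConeTreeVert A d) where
  edges := coneTreeEdges X d
  uniform := card_of_mem_coneTreeEdges hX d

variable {W : Type}

/-- `f` is a copy of the tree of cones of depth `d` with root `v`, in the hypergraph with edge set
`E`. -/
def IsConeTreeCopy (X : Finset (Finset A)) (E : Finset (Finset W)) (d : ℕ) (v : W)
    (f : ConeTreeVert A d ↪ W) : Prop :=
  f (coneTreeRoot A d) = v ∧ ∀ e ∈ coneTreeEdges X d, e.map f ∈ E

theorem exists_isConeTreeCopy_succ {E : Finset (Finset W)} {d : ℕ} {v : W} (g : A ↪ W)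
    (hg : ∀ f ∈ X, insert v (f.map g) ∈ E) (h : A → (ConeTreeVert A d ↪ W))
    (hcopy : ∀ a, IsConeTreeCopy X E d (g a) (h a))
    (hdisj : ∀ a b x y, h a x = h b y → a = b) (hv : ∀ a x, h a x ≠ v) :
    ∃ F : ConeTreeVert A (d + 1) ↪ W, IsConeTreeCopy X E (d + 1) v F ∧
      ∀ x, F x = v ∨ ∃ a y, F x = h a y := by
  let F₀ : ConeTreeVert A (d + 1) → W := fun x =>
    Option.elim (x : Option (A × ConeTreeVert A d)) v fun p => h p.1 p.2
  have hroot : F₀ (coneTreeRoot A (d + 1)) = v := rfl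
  have hbr : ∀ a x, F₀ (coneTreeBranch d a x) = h a x := fun _ _ => rfl
  have hinj : Function.Injective F₀ := by
    intro x y hxy
    rcases coneTreeVert_succ_cases x with rfl | ⟨a, x', rfl⟩ <;>
      rcases coneTreeVert_succ_cases y with rfl | ⟨b, y', rfl⟩
    · rfl
    · rw [hroot, hbr] at hxy
      exact absurd hxy.symm (hv _ _)
    · rw [hroot, hbr] at hxy
      exact absurd hxy (hv _ _)
    · rw [hbr, hbr] at hxy
      obtain rfl := hdisj _ _ _ _ hxy
      rw [(h a).injective hxy]
  refine ⟨⟨F₀, hinj⟩, ⟨hroot, fun e he => ?_⟩, fun x => ?_⟩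
  · rcases mem_coneTreeEdges_succ.mp he with ⟨f, hf, rfl⟩ | ⟨a, e', he', rfl⟩
    · convert hg f hf using 1
      rw [Finset.map_insert, Finset.map_map]
      congr 2
      ext a
      exact (hcopy a).1
    · convert (hcopy a).2 e' he' using 1
      rw [Finset.map_map]
      rfl
  · rcases coneTreeVert_succ_cases x with rfl | ⟨a, x', rfl⟩
    · exact Or.inl rfl
    · exact Or.inr ⟨a, x', rfl⟩

/-- Greedy choice of pairwise disjoint sets. -/
theorem exists_disjoint_system {I : Type*} (P : I → Finset W → Prop) (t : ℕ) (Z : Finset W)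
    (s : Finset I)
    (hP : ∀ i ∈ s, ∀ Z' : Finset W, Z ⊆ Z' → Z'.card ≤ Z.card + s.card * t →
      ∃ S, P i S ∧ S.card ≤ t ∧ Disjoint S Z') :
    ∃ S : I → Finset W, (∀ i ∈ s, P i (S i) ∧ (S i).card ≤ t ∧ Disjoint (S i) Z) ∧
      ∀ i ∈ s, ∀ j ∈ s, i ≠ j → Disjoint (S i) (S j) := by
  induction s using Finset.induction_on with
  | empty => exact ⟨fun _ => ∅, by simp, by simp⟩
  | insert a s ha ih =>
    rw [Finset.card_insert_of_notMem ha] at hP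
    obtain ⟨S, h1, h2⟩ := ih fun i hi Z' hZ hc =>
      hP i (Finset.mem_insert_of_mem hi) Z' hZ (hc.trans (by rw [add_one_mul]; omega))
    have hcard : (Z ∪ s.biUnion S).card ≤ Z.card + (s.card + 1) * t := by
      refine (Finset.card_union_le _ _).trans (Nat.add_le_add_left ?_ _)
      refine (Finset.card_biUnion_le_card_mul _ _ t fun i hi => (h1 i hi).2.1).trans ?_
      exact Nat.mul_le_mul_right _ (Nat.le_succ _)
    obtain ⟨T, hT1, hT2, hT3⟩ := hP a (Finset.mem_insert_self _ _) _ Finset.subset_union_left hcard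
    rw [Finset.disjoint_union_right, Finset.disjoint_biUnion_right] at hT3
    have hne : ∀ i ∈ s, i ≠ a := fun i hi h => ha (h ▸ hi)
    refine ⟨Function.update S a T, ?_, ?_⟩
    · intro i hi
      rcases Finset.mem_insert.mp hi with rfl | hi
      · simpa using ⟨hT1, hT2, hT3.1⟩
      · simpa [Function.update_of_ne (hne i hi)] using h1 i hi
    · intro i hi j hj hij
      rcases Finset.mem_insert.mp hi with hi' | hi' <;>
        rcases Finset.mem_insert.mp hj with hj' | hj'
      · exact absurd (hi'.trans hj'.symm) hij
      · simpa [hi', Function.update_of_ne (hne j hj')] using hT3.2 j hj'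
      · simpa [hj', Function.update_of_ne (hne i hi')] using (hT3.2 i hi').symm
      · simpa [Function.update_of_ne (hne i hi'), Function.update_of_ne (hne j hj')]
          using h2 i hi' j hj' hij

/-- Copies of the tree of cones with root `v` cannot be destroyed by the removal of `M` vertices
other than `v`. -/
def RichRoot (X : Finset (Finset A)) (E : Finset (Finset W)) (M d : ℕ) (v : W) : Prop :=
  ∀ Z : Finset W, Z.card ≤ M → v ∉ Z →
    ∃ f : ConeTreeVert A d ↪ W, IsConeTreeCopy X E d v f ∧ ∀ x, f x ∉ Z

theorem richRoot_zero (E : Finset (Finset W)) (M : ℕ) (v : W) : RichRoot X E M 0 v := by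
  intro Z _ hv
  refine ⟨⟨fun _ => v, fun _ _ _ => rfl⟩, ⟨rfl, fun e he => ?_⟩, fun _ => hv⟩
  simp [coneTreeEdges] at he

/-- Branches are grown greedily at the base vertices of a cone. The budget `M` covers `Z`, the root,
the base and all branches chosen before. -/
theorem exists_isConeTreeCopy_avoiding {E : Finset (Finset W)} {M d : ℕ} {v : W} {Z : Finset W}
    (hvZ : v ∉ Z) (g : A ↪ W) (hgv : ∀ a, g a ≠ v) (hgZ : ∀ a, g a ∉ Z)
    (hg : ∀ f ∈ X, insert v (f.map g) ∈ E) (hrich : ∀ a, RichRoot X E M d (g a))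
    (hM : Z.card + (1 + Fintype.card A + Fintype.card A * Nat.card (ConeTreeVert A d)) ≤ M) :
    ∃ f : ConeTreeVert A (d + 1) ↪ W, IsConeTreeCopy X E (d + 1) v f ∧ ∀ x, f x ∉ Z := by
  have : Fintype (ConeTreeVert A d) := Fintype.ofFinite _
  rw [Nat.card_eq_fintype_card] at hM
  set Z₁ : Finset W := insert v (Z ∪ Finset.univ.map g) with hZ₁
  have hZ₁card : Z₁.card ≤ Z.card + (1 + Fintype.card A) := by
    refine (Finset.card_insert_le _ _).trans ?_
    have := Finset.card_union_le Z (Finset.univ.map g)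
    rw [Finset.card_map, Finset.card_univ] at this
    omega
  obtain ⟨S, hS, hSd⟩ := exists_disjoint_system
    (fun a S => ∃ f : ConeTreeVert A d ↪ W, IsConeTreeCopy X E d (g a) f ∧
      -- The root of a branch is left out because all base vertices already belong to the forbidden
      -- set `Z₁`.
      S = (Finset.univ.map f).erase (g a))
    (Fintype.card (ConeTreeVert A d)) Z₁ Finset.univ (by
      intro a _ Z' _ hZ'
      rw [Finset.card_univ] at hZ'
      obtain ⟨f, hf, hfZ⟩ := hrich a (Z'.erase (g a))
        ((Finset.card_erase_le).trans (by omega)) (Finset.notMem_erase _ _)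
      refine ⟨_, ⟨f, hf, rfl⟩, ?_, ?_⟩
      · refine Finset.card_erase_le.trans ?_
        rw [Finset.card_map, Finset.card_univ]
      · rw [Finset.disjoint_left]
        intro x hx hxZ
        rw [Finset.mem_erase, Finset.mem_map] at hx
        obtain ⟨hx1, y, -, rfl⟩ := hx
        exact hfZ y (Finset.mem_erase.mpr ⟨hx1, hxZ⟩))
  choose h hcopy hSh using fun a => (hS a (Finset.mem_univ a)).1
  have hdisjZ : ∀ a, Disjoint (S a) Z₁ := fun a => (hS a (Finset.mem_univ a)).2.2
  have hmem : ∀ a x, h a x = g a ∨ h a x ∈ S a := by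
    intro a x
    by_cases hx : h a x = g a
    · exact Or.inl hx
    · right
      rw [hSh a]
      exact Finset.mem_erase.mpr ⟨hx, Finset.mem_map_of_mem _ (Finset.mem_univ _)⟩
  have hgZ₁ : ∀ a, g a ∈ Z₁ := fun a => by simp [hZ₁]
  have hnot : ∀ a, ∀ x ∈ S a, x ∉ Z₁ := fun a x hx => Finset.disjoint_left.mp (hdisjZ a) hx
  obtain ⟨F, hF, hFx⟩ := exists_isConeTreeCopy_succ g hg h hcopy
    (by
      intro a b x y hxy
      by_contra hab
      rcases hmem a x with h1 | h1 <;> rcases hmem b y with h2 | h2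
      · exact hab (g.injective (by rw [← h1, ← h2, hxy]))
      · exact hnot b _ h2 (by rw [← hxy, h1]; exact hgZ₁ a)
      · exact hnot a _ h1 (by rw [hxy, h2]; exact hgZ₁ b)
      · exact Finset.disjoint_left.mp (hSd a (Finset.mem_univ a) b (Finset.mem_univ b) hab) h1
          (hxy ▸ h2))
    (by
      intro a x hx
      rcases hmem a x with h1 | h1
      · exact hgv a (by rw [← h1, hx])
      · exact hnot a _ h1 (by rw [hx]; simp [hZ₁]))
  refine ⟨F, hF, fun x hx => ?_⟩
  rcases hFx x with h1 | ⟨a, y, h1⟩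
  · exact hvZ (h1 ▸ hx)
  · rw [h1] at hx
    rcases hmem a y with h2 | h2
    · exact hgZ a (h2 ▸ hx)
    · exact hnot a _ h2 (by simp [hZ₁, hx])

end ConeTree

/-! ### Expansion of the complete graph. -/

section Expansion

open scoped Classical

/-- The vertices of the expansion of the complete graph on `r + 1` vertices to an `r`-graph: the
`r + 1` core vertices, and `r - 2` further vertices for each pair of them. -/
abbrev ExpansionVert (r : ℕ) : Type :=
  Fin (r + 1) ⊕ {p : Fin (r + 1) × Fin (r + 1) // p.1 < p.2} × Fin (r - 2)

/-- The edge of the expansion that covers a given pair of core vertices. -/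
noncomputable def expansionEdge (r : ℕ) (p : {p : Fin (r + 1) × Fin (r + 1) // p.1 < p.2}) :
    Finset (ExpansionVert r) :=
  insert (Sum.inl p.1.1) (insert (Sum.inl p.1.2)
    (Finset.univ.map ⟨fun l : Fin (r - 2) => (Sum.inr (p, l) : ExpansionVert r),
      fun a b h => by simpa using h⟩))

/-- The edges of the expansion of the complete graph on `r + 1` vertices. -/
noncomputable def expansionEdges (r : ℕ) : Finset (Finset (ExpansionVert r)) :=
  Finset.univ.image (expansionEdge r)

theorem card_of_mem_expansionEdges {r : ℕ} (hr : 2 ≤ r) :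
    ∀ f ∈ expansionEdges r, f.card = r := by
  intro f hf
  obtain ⟨p, -, rfl⟩ := Finset.mem_image.mp hf
  have hne : p.1.1 ≠ p.1.2 := p.2.ne
  rw [expansionEdge, Finset.card_insert_of_notMem, Finset.card_insert_of_notMem, Finset.card_map,
    Finset.card_univ, Fintype.card_fin]
  · omega
  · simp
  · simp [hne]

end Expansion

/-! ### Ranking the vertices and deleting the few bad edges. -/

section Cleaning

open scoped Classical

variable {r : ℕ}

/-- The edges `e` that contain no vertex of `Z v x y`, other than `v`, `x` and `y`, for any vertices
`v`, `x`, `y` of `e`. -/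
noncomputable def edgesAvoiding {W : Type} [Fintype W] (E : Finset (Finset W))
    (Z : W → W → W → Finset W) :
    Finset (Finset W) :=
  E.filter fun e => ∀ v ∈ e, ∀ x ∈ e, ∀ y ∈ e, ∀ z ∈ e, z ≠ v → z ≠ x → z ≠ y → z ∉ Z v x y

/-- A lost edge is recovered from its `r` vertices other than the bad vertex `z`, a triple among
them, and the choice of `z` in the set of at most `B` vertices attached to the triple. -/
theorem card_le_card_edgesAvoiding {W : Type} [Fintype W] {E : Finset (Finset W)}
    (hcard : ∀ e ∈ E, e.card = r + 1)
    {Z : W → W → W → Finset W} {B : ℕ} (hB : ∀ v x y, (Z v x y).card ≤ B) :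
    E.card ≤ (edgesAvoiding E Z).card + r * r * r * B * Fintype.card W ^ r := by
  set T : Finset (Finset W) := (Finset.univ.powersetCard r).biUnion fun q =>
    (q ×ˢ q ×ˢ q).biUnion fun p => (Z p.1 p.2.1 p.2.2).image fun z => insert z q with hT
  have hsub : E ⊆ edgesAvoiding E Z ∪ T := by
    intro e he
    by_cases h : e ∈ edgesAvoiding E Z
    · exact Finset.mem_union_left _ h
    refine Finset.mem_union_right _ ?_
    rw [edgesAvoiding, Finset.mem_filter] at h
    push Not at h
    obtain ⟨v, hv, x, hx, y, hy, z, hz, hzv, hzx, hzy, hzZ⟩ := h he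
    simp only [hT, Finset.mem_biUnion, Finset.mem_image]
    refine ⟨e.erase z, ?_, (v, x, y), ?_, z, hzZ, Finset.insert_erase hz⟩
    · rw [Finset.mem_powersetCard_univ, Finset.card_erase_of_mem hz, hcard e he]
      rfl
    · simp [hv, hx, hy, hzv.symm, hzx.symm, hzy.symm]
  have hTcard : T.card ≤ r * r * r * B * Fintype.card W ^ r := by
    refine (Finset.card_biUnion_le_card_mul _ _ (r * (r * r) * B) fun q hq => ?_).trans ?_
    · refine (Finset.card_biUnion_le_card_mul _ _ B fun p _ =>
        Finset.card_image_le.trans (hB _ _ _)).trans ?_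
      rw [Finset.card_product, Finset.card_product, (Finset.mem_powersetCard.mp hq).2]
    · rw [Finset.card_powersetCard, Finset.card_univ, mul_comm, ← mul_assoc r r r]
      exact Nat.mul_le_mul_left _ (Nat.choose_le_pow _ _)
  calc E.card ≤ _ := Finset.card_le_card hsub
    _ ≤ _ := Finset.card_union_le _ _
    _ ≤ _ := Nat.add_le_add_left hTcard _

/-- If the pairs of an `(r + 1)`-set are robustly covered by the link of `v`, then the link contains
an expansion of the complete graph. -/
theorem exists_expansion_embedding {W : Type} (hr : 2 ≤ r) {E : Finset (Finset W)}
    (hcard : ∀ e ∈ E, e.card = r + 1) {rk : W → ℕ} {v : W} {Z K : Finset W}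
    (hK : K.card = r + 1) (hvK : v ∉ K) (hKZ : Disjoint K Z) (hKrk : ∀ x ∈ K, rk v ≤ rk x)
    {B : ℕ} (hB : Z.card + (r + 2) + (r + 1) * (r + 1) * (r + 1) ≤ B)
    (hthick : ∀ x ∈ K, ∀ y ∈ K, x ≠ y → ∀ Z' : Finset W, Z'.card ≤ B → v ∉ Z' → x ∉ Z' → y ∉ Z' →
      ∃ e ∈ E, v ∈ e ∧ x ∈ e ∧ y ∈ e ∧ (∀ z ∈ e, rk v ≤ rk z) ∧ Disjoint e Z') :
    ∃ g : ExpansionVert r ↪ W, (∀ a, g a ≠ v) ∧ (∀ a, g a ∉ Z) ∧ (∀ a, rk v ≤ rk (g a)) ∧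
      ∀ f ∈ expansionEdges r, insert v (f.map g) ∈ E := by
  set κ : Fin (r + 1) ≃ K := (Finset.equivFinOfCardEq hK).symm with hκ
  set Z₁ : Finset W := insert v (Z ∪ K) with hZ₁
  have hZ₁card : Z₁.card ≤ Z.card + (r + 2) := by
    refine (Finset.card_insert_le _ _).trans ?_
    have := Finset.card_union_le Z K
    omega
  have hvκ : ∀ i, (κ i : W) ≠ v := fun i h => hvK (h ▸ (κ i).2)
  have hκinj : ∀ i j, (κ i : W) = κ j → i = j := fun i j h => κ.injective (Subtype.ext h)
  obtain ⟨S, hS, hSd⟩ := exists_disjoint_system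
    (I := {p : Fin (r + 1) × Fin (r + 1) // p.1 < p.2})
    (fun p S => S.card = r - 2 ∧ insert v (insert (κ p.1.1 : W) (insert (κ p.1.2 : W) S)) ∈ E ∧
      ∀ z ∈ S, rk v ≤ rk z) (r + 1) Z₁ Finset.univ (by
      intro p _ Z' hZZ' hZ'
      have hpc : (Finset.univ : Finset {p : Fin (r + 1) × Fin (r + 1) // p.1 < p.2}).card
          ≤ (r + 1) * (r + 1) := by
        rw [Finset.card_univ]
        refine (Fintype.card_subtype_le _).trans ?_
        simp
      have hxy : (κ p.1.1 : W) ≠ κ p.1.2 := fun h => p.2.ne (hκinj _ _ h)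
      -- The edge sought must contain these three vertices, so only its further vertices have to
      -- avoid `Z'`.
      set Z₂ := ((Z'.erase v).erase (κ p.1.1 : W)).erase (κ p.1.2 : W) with hZ₂
      have hZ₂card : Z₂.card ≤ B := by
        have h1 : Z₂.card ≤ Z'.card :=
          Finset.card_le_card ((Finset.erase_subset _ _).trans
            ((Finset.erase_subset _ _).trans (Finset.erase_subset _ _)))
        have h2 := Nat.mul_le_mul_right (r + 1) hpc
        omega
      obtain ⟨e, he, h1, h2, h3, h4, h5⟩ := hthick _ (κ p.1.1).2 _ (κ p.1.2).2 hxy Z₂ hZ₂card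
        (by simp [hZ₂]) (by simp [hZ₂]) (by simp [hZ₂])
      have hxm : (κ p.1.1 : W) ∈ e.erase v := Finset.mem_erase.mpr ⟨hvκ _, h2⟩
      have hym : (κ p.1.2 : W) ∈ (e.erase v).erase (κ p.1.1 : W) :=
        Finset.mem_erase.mpr ⟨hxy.symm, Finset.mem_erase.mpr ⟨hvκ _, h3⟩⟩
      refine ⟨((e.erase v).erase (κ p.1.1 : W)).erase (κ p.1.2 : W), ⟨?_, ?_, ?_⟩, ?_, ?_⟩
      · rw [Finset.card_erase_of_mem hym, Finset.card_erase_of_mem hxm,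
          Finset.card_erase_of_mem h1, hcard e he]
        omega
      · rwa [Finset.insert_erase hym, Finset.insert_erase hxm,
          Finset.insert_erase h1]
      · intro z hz
        simp only [Finset.mem_erase] at hz
        exact h4 z hz.2.2.2
      · refine (Finset.card_le_card ((Finset.erase_subset _ _).trans
            ((Finset.erase_subset _ _).trans (Finset.erase_subset _ _)))).trans (hcard e he).le
      · rw [Finset.disjoint_left] at h5 ⊢
        intro z hz hzZ
        simp only [Finset.mem_erase] at hz
        refine h5 hz.2.2.2 ?_
        simp only [hZ₂, Finset.mem_erase]
        exact ⟨hz.1, hz.2.1, hz.2.2.1, hzZ⟩)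
  have hScard : ∀ p, (S p).card = r - 2 := fun p => (hS p (Finset.mem_univ p)).1.1
  have hSE := fun p => (hS p (Finset.mem_univ p)).1.2.1
  have hSrk := fun p => (hS p (Finset.mem_univ p)).1.2.2
  have hSZ : ∀ p, ∀ z ∈ S p, z ∉ Z₁ := fun p z hz =>
    Finset.disjoint_left.mp (hS p (Finset.mem_univ p)).2.2 hz
  set ε : ∀ p, Fin (r - 2) ≃ S p := fun p => (Finset.equivFinOfCardEq (hScard p)).symm with hε
  let g₀ : ExpansionVert r → W := Sum.elim (fun i => (κ i : W)) fun q => (ε q.1 q.2 : W)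
  have hKZ₁ : ∀ i, (κ i : W) ∈ Z₁ := fun i => by simp [hZ₁]
  have hinj : Function.Injective g₀ := by
    rintro (i | ⟨p, l⟩) (j | ⟨q, m⟩) h
    · rw [hκinj i j h]
    · exact absurd (hKZ₁ i) (by
        have : (κ i : W) = ε q m := h
        rw [this]
        exact hSZ q _ (ε q m).2)
    · exact absurd (hKZ₁ j) (by
        have : (ε p l : W) = κ j := h
        rw [← this]
        exact hSZ p _ (ε p l).2)
    · have h' : (ε p l : W) = ε q m := h
      have hpq : p = q := by
        by_contra hpq
        refine Finset.disjoint_left.mp (hSd p (Finset.mem_univ p) q (Finset.mem_univ q) hpq)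
          (ε p l).2 ?_
        rw [h']
        exact (ε q m).2
      subst hpq
      rw [(ε p).injective (Subtype.ext h')]
  refine ⟨⟨g₀, hinj⟩, ?_, ?_, ?_, ?_⟩
  · rintro (i | ⟨p, l⟩) h
    · exact hvκ i h
    · exact hSZ p _ (ε p l).2 (by
        have : (ε p l : W) = v := h
        rw [this]
        simp [hZ₁])
  · rintro (i | ⟨p, l⟩) h
    · exact Finset.disjoint_left.mp hKZ (κ i).2 h
    · exact hSZ p _ (ε p l).2 (by
        have : (ε p l : W) ∈ Z := h
        simp [hZ₁, this])
  · rintro (i | ⟨p, l⟩)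
    · exact hKrk _ (κ i).2
    · exact hSrk p _ (ε p l).2
  · intro f hf
    obtain ⟨p, -, rfl⟩ := Finset.mem_image.mp hf
    convert hSE p using 1
    rw [expansionEdge, Finset.map_insert, Finset.map_insert, Finset.map_map]
    congr 3
    ext z
    simp only [Finset.mem_map, Finset.mem_univ, true_and]
    constructor
    · rintro ⟨l, rfl⟩
      exact (ε p l).2
    · intro hz
      exact ⟨(ε p).symm ⟨z, hz⟩, congrArg Subtype.val ((ε p).apply_symm_apply ⟨z, hz⟩)⟩

/-- An `(r + 1)`-graph without a copy of the tree of cones of depth `D` becomes, after the removal of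
few edges, one to which `exists_card_le_of_ranked` applies. -/
theorem exists_ranked_subset (hr : 2 ≤ r) {D : ℕ} (hD : 0 < D) :
    ∃ C : ℕ, ∀ (W : Type) [Fintype W] (H : KGraph (r + 1) W),
      ¬ H.ContainsCopy (coneTree (expansionEdges r) (card_of_mem_expansionEdges hr) D) →
      ∃ (E : Finset (Finset W)) (rk : W → ℕ), (∀ e ∈ E, e.card = r + 1) ∧ (∀ v, rk v < D) ∧
        (∀ v, cliquesOfCard (linkShadow E rk v) (r + 1) = ∅) ∧
        H.edges.card ≤ E.card + C * Fintype.card W ^ r := by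
  -- `Q` bounds the vertices used when a tree grows by one level. Depth `j` gets the budget `(D - j)
  -- * Q`, so each level costs one `Q`, and at depth `D` nothing is left but a plain copy, which is
  -- excluded.
  set Q : ℕ := 1 + Fintype.card (ExpansionVert r) +
    Fintype.card (ExpansionVert r) *
      ∑ j ∈ Finset.range D, Nat.card (ConeTreeVert (ExpansionVert r) j) with hQ
  set B : ℕ := D * Q + (r + 2) + (r + 1) * (r + 1) * (r + 1) with hBdef
  refine ⟨r * r * r * (D * Q + B), ?_⟩
  intro W _ H hH
  have hex : ∀ v, ∃ j, ¬ RichRoot (expansionEdges r) H.edges ((D - (j + 1)) * Q) (j + 1) v := by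
    intro v
    refine ⟨D - 1, fun h => hH ?_⟩
    rw [Nat.sub_add_cancel hD] at h
    obtain ⟨f, hf, -⟩ := h ∅ (by simp) (by simp)
    exact ⟨f, hf.2⟩
  set rk : W → ℕ := fun v => Nat.find (hex v) with hrk
  have hrkD : ∀ v, rk v < D := by
    intro v
    have : rk v ≤ D - 1 := Nat.find_min' (hex v) (by
      intro h
      rw [Nat.sub_add_cancel hD] at h
      obtain ⟨f, hf, -⟩ := h ∅ (by simp) (by simp)
      exact hH ⟨f, hf.2⟩)
    omega
  have hrich : ∀ v, ∀ j ≤ rk v, RichRoot (expansionEdges r) H.edges ((D - j) * Q) j v := by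
    intro v j hj
    cases j with
    | zero => exact richRoot_zero _ _ _
    | succ j => exact not_not.mp (Nat.find_min (hex v) hj)
  have hpoor : ∀ v, ∃ Z : Finset W, Z.card ≤ (D - (rk v + 1)) * Q ∧ v ∉ Z ∧
      ¬ ∃ f : ConeTreeVert (ExpansionVert r) (rk v + 1) ↪ W,
        IsConeTreeCopy (expansionEdges r) H.edges (rk v + 1) v f ∧ ∀ x, f x ∉ Z := by
    intro v
    have := Nat.find_spec (hex v)
    rw [RichRoot] at this
    push Not at this
    obtain ⟨Z, h1, h2, h3⟩ := this
    exact ⟨Z, h1, h2, fun ⟨f, hf, hx⟩ => by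
      obtain ⟨x, hx'⟩ := h3 f hf
      exact hx x hx'⟩
  choose Z hZcard hvZ hZ using hpoor
  have hZD : ∀ v, (Z v).card ≤ D * Q := fun v =>
    (hZcard v).trans (Nat.mul_le_mul_right _ (Nat.sub_le _ _))
  -- If few vertices hit all relevant edges through `v, x, y`, they form `T`; otherwise `T` is
  -- irrelevant. An edge that avoids `T` thus shows that its pair `x, y` is robustly covered.
  have hthin : ∀ v x y, ∃ T : Finset W, T.card ≤ B ∧
      ((∃ Z' : Finset W, Z'.card ≤ B ∧ v ∉ Z' ∧ x ∉ Z' ∧ y ∉ Z' ∧ ∀ e ∈ H.edges, v ∈ e → x ∈ e →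
          y ∈ e → (∀ z ∈ e, rk v ≤ rk z) → ¬ Disjoint e Z') →
        v ∉ T ∧ x ∉ T ∧ y ∉ T ∧ ∀ e ∈ H.edges, v ∈ e → x ∈ e →
          y ∈ e → (∀ z ∈ e, rk v ≤ rk z) → ¬ Disjoint e T) := by
    intro v x y
    by_cases h : ∃ Z' : Finset W, Z'.card ≤ B ∧ v ∉ Z' ∧ x ∉ Z' ∧ y ∉ Z' ∧ ∀ e ∈ H.edges, v ∈ e →
        x ∈ e → y ∈ e → (∀ z ∈ e, rk v ≤ rk z) → ¬ Disjoint e Z'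
    · obtain ⟨Z', h1, h2⟩ := h
      exact ⟨Z', h1, fun _ => h2⟩
    · exact ⟨∅, by simp, fun h' => absurd h' h⟩
  choose T hTcard hT using hthin
  set Y : W → W → W → Finset W := fun v x y => Z v ∪ T v x y with hY
  have hYcard : ∀ v x y, (Y v x y).card ≤ D * Q + B := fun v x y =>
    (Finset.card_union_le _ _).trans (add_le_add (hZD v) (hTcard v x y))
  refine ⟨edgesAvoiding H.edges Y, rk, fun e he => H.uniform e (Finset.mem_filter.mp he).1, hrkD,
    ?_, card_le_card_edgesAvoiding H.uniform hYcard⟩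
  intro v
  rw [Finset.eq_empty_iff_forall_notMem]
  intro K hK
  rw [mem_cliquesOfCard] at hK
  obtain ⟨hKcard, hKcl⟩ := hK
  have hadj : ∀ x ∈ K, ∃ y ∈ K, (linkShadow (edgesAvoiding H.edges Y) rk v).Adj x y := by
    intro x hx
    have : (K.erase x).Nonempty := by
      rw [← Finset.card_pos, Finset.card_erase_of_mem hx, hKcard]
      omega
    obtain ⟨y, hy⟩ := this
    rw [Finset.mem_erase] at hy
    exact ⟨y, hy.2, hKcl hx hy.2 hy.1.symm⟩
  have hvK : v ∉ K := by
    intro h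
    obtain ⟨y, -, h'⟩ := hadj v h
    exact h'.2.1 rfl
  have hKrk : ∀ x ∈ K, rk v ≤ rk x := by
    intro x hx
    obtain ⟨y, -, -, -, -, e, -, -, h4, -, h6⟩ := hadj x hx
    exact h6 x h4
  have hKZ : Disjoint K (Z v) := by
    rw [Finset.disjoint_left]
    intro x hx hxZ
    obtain ⟨y, -, -, h2, -, e, he, h3, h4, -, -⟩ := hadj x hx
    exact (Finset.mem_filter.mp he).2 v h3 v h3 v h3 x h4 h2 h2 h2
      (Finset.mem_union_left _ hxZ)
  have hthick : ∀ x ∈ K, ∀ y ∈ K, x ≠ y → ∀ Z' : Finset W, Z'.card ≤ B → v ∉ Z' → x ∉ Z' →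
      y ∉ Z' → ∃ e ∈ H.edges, v ∈ e ∧ x ∈ e ∧ y ∈ e ∧ (∀ z ∈ e, rk v ≤ rk z) ∧ Disjoint e Z' := by
    intro x hx y hy hxy Z' h1 h2 h3 h4
    by_contra hcon
    push Not at hcon
    obtain ⟨t1, t2, t3, t4⟩ := hT v x y ⟨Z', h1, h2, h3, h4, hcon⟩
    obtain ⟨-, -, -, e, he, h5, h6, h7, h8⟩ := hKcl hx hy hxy
    have he' := Finset.mem_filter.mp he
    refine t4 e he'.1 h5 h6 h7 h8 (Finset.disjoint_left.mpr fun z hz hzT => ?_)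
    exact he'.2 v h5 x h6 y h7 z hz (fun h => t1 (h ▸ hzT)) (fun h => t2 (h ▸ hzT))
      (fun h => t3 (h ▸ hzT)) (Finset.mem_union_right _ hzT)
  have hBZ : (Z v).card + (r + 2) + (r + 1) * (r + 1) * (r + 1) ≤ B := by
    have := hZD v
    omega
  obtain ⟨g, hgv, hgZ, hgrk, hg⟩ :=
    exists_expansion_embedding hr H.uniform hKcard hvK hKZ hKrk hBZ hthick
  -- All base vertices have rank at least `rk v`, hence are rich at depth exactly `rk v`. The new
  -- cone gives `v` a tree of depth `rk v + 1` avoiding `Z v`, which was chosen to prevent it.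
  refine hZ v (exists_isConeTreeCopy_avoiding (hvZ v) g hgv hgZ hg
    (fun a => hrich (g a) (rk v) (hgrk a)) ?_)
  have h1 : Nat.card (ConeTreeVert (ExpansionVert r) (rk v))
      ≤ ∑ j ∈ Finset.range D, Nat.card (ConeTreeVert (ExpansionVert r) j) :=
    Finset.single_le_sum (f := fun j => Nat.card (ConeTreeVert (ExpansionVert r) j))
      (fun _ _ => Nat.zero_le _)
      (Finset.mem_range.mpr (hrkD v))
  have h2 : 1 + Fintype.card (ExpansionVert r) + Fintype.card (ExpansionVert r) *
      Nat.card (ConeTreeVert (ExpansionVert r) (rk v)) ≤ Q := by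
    rw [hQ]
    exact Nat.add_le_add_left (Nat.mul_le_mul_left _ h1) _
  have h3 : D - rk v = (D - (rk v + 1)) + 1 := by
    have := hrkD v
    omega
  rw [h3, add_one_mul]
  exact add_le_add (hZcard v) h2

end Cleaning

/-! ### Existence of Turán densities by averaging. -/

namespace KGraph

section ExtremalNumber

open scoped Classical

variable {k : ℕ} {V : Type*}

/-- The hypergraph induced on the image of an embedding, pulled back. -/
noncomputable def comap {U W : Type*} [Fintype U] (φ : U ↪ W) (H : KGraph k W) : KGraph k U where
  edges := Finset.univ.filter fun e => e.map φ ∈ H.edges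
  uniform := fun e he => by
    rw [← Finset.card_map φ]
    exact H.uniform _ (Finset.mem_filter.mp he).2

theorem not_containsCopy_comap {U W : Type*} [Fintype U] (φ : U ↪ W) {H : KGraph k W}
    {F : KGraph k V} (h : ¬ H.ContainsCopy F) : ¬ (H.comap φ).ContainsCopy F := by
  rintro ⟨f, hf⟩
  refine h ⟨f.trans φ, fun e he => ?_⟩
  rw [← Finset.map_map]
  exact (Finset.mem_filter.mp (hf e he)).2

theorem card_le_card_comap {U W : Type*} [Fintype U] (φ : U ↪ W) (H : KGraph k W)
    {S : Finset (Finset W)} (hS : S ⊆ H.edges) (hφ : ∀ e ∈ S, ∀ x ∈ e, x ∈ Set.range φ) :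
    S.card ≤ (H.comap φ).edges.card := by
  rw [← Finset.card_map (Finset.mapEmbedding φ).toEmbedding]
  refine Finset.card_le_card fun e he => ?_
  have hpre : (Finset.univ.filter fun u => φ u ∈ e).map φ = e := by
    ext x
    simp only [Finset.mem_map, Finset.mem_filter, Finset.mem_univ, true_and]
    constructor
    · rintro ⟨u, hu, rfl⟩
      exact hu
    · intro hx
      obtain ⟨u, rfl⟩ := hφ e he x hx
      exact ⟨u, hx, rfl⟩
  refine Finset.mem_map.mpr ⟨Finset.univ.filter fun u => φ u ∈ e, ?_, hpre⟩
  refine Finset.mem_filter.mpr ⟨Finset.mem_univ _, ?_⟩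
  rw [hpre]
  exact hS he

theorem bddAbove_card_edges (n : ℕ) (F : KGraph k V) :
    BddAbove {m : ℕ | ∃ H : KGraph k (Fin n), ¬ H.ContainsCopy F ∧ H.edges.card = m} := by
  refine ⟨Fintype.card (Finset (Fin n)), ?_⟩
  rintro m ⟨H, -, rfl⟩
  exact Finset.card_le_univ _

theorem card_edges_le_extremalNumber {W : Type*} [Fintype W] {n : ℕ} (hn : Fintype.card W = n)
    {F : KGraph k V} {H : KGraph k W} (h : ¬ H.ContainsCopy F) :
    H.edges.card ≤ extremalNumber n F := by
  let φ : Fin n ≃ W := (Fintype.equivFinOfCardEq hn).symm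
  refine le_trans ?_ (le_csSup (bddAbove_card_edges n F)
    ⟨H.comap φ.toEmbedding, not_containsCopy_comap _ h, rfl⟩)
  exact card_le_card_comap φ.toEmbedding H (Finset.Subset.refl _) fun e _ x _ =>
    ⟨φ.symm x, φ.apply_symm_apply x⟩

theorem exists_card_edges_eq_extremalNumber (n : ℕ) {F : KGraph k V} (hF : F.edges.Nonempty) :
    ∃ H : KGraph k (Fin n), ¬ H.ContainsCopy F ∧ H.edges.card = extremalNumber n F := by
  refine Nat.sSup_mem ?_ (bddAbove_card_edges n F)
  refine ⟨0, ⟨∅, by simp⟩, ?_, rfl⟩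
  rintro ⟨f, hf⟩
  obtain ⟨e, he⟩ := hF
  simpa using hf e he

/-- Delete each vertex of an extremal hypergraph in turn: every edge survives `n + 1 - k` deletions.
-/
theorem extremalNumber_succ_mul_le (n : ℕ) {F : KGraph k V} (hF : F.edges.Nonempty) :
    extremalNumber (n + 1) F * (n + 1 - k) ≤ (n + 1) * extremalNumber n F := by
  obtain ⟨H, hH, hcard⟩ := exists_card_edges_eq_extremalNumber (n + 1) hF
  have hv : ∀ v : Fin (n + 1), (H.edges.filter fun e => v ∉ e).card ≤ extremalNumber n F := by
    intro v
    have hc : Fintype.card {x : Fin (n + 1) // x ≠ v} = n := by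
      rw [Fintype.card_subtype_compl, Fintype.card_fin, Fintype.card_subtype_eq]
      rfl
    refine le_trans ?_ (card_edges_le_extremalNumber hc
      (not_containsCopy_comap (Function.Embedding.subtype _) hH))
    refine card_le_card_comap _ H (Finset.filter_subset _ _) fun e he x hx => ?_
    exact ⟨⟨x, fun h => (Finset.mem_filter.mp he).2 (h ▸ hx)⟩, rfl⟩
  have hdc : ∑ e ∈ H.edges, (Finset.univ.filter fun v => v ∉ e).card
      = ∑ v, (H.edges.filter fun e => v ∉ e).card :=
    Finset.sum_card_bipartiteAbove_eq_sum_card_bipartiteBelow (fun e v => v ∉ e)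
  have hleft : ∑ e ∈ H.edges, (Finset.univ.filter fun v => v ∉ e).card
      = H.edges.card * (n + 1 - k) := by
    rw [Finset.sum_congr rfl (g := fun _ => n + 1 - k)]
    · simp
    · intro e he
      have : (Finset.univ.filter fun v => v ∉ e) = eᶜ := by ext v; simp
      rw [this, Finset.card_compl, H.uniform e he, Fintype.card_fin]
  rw [← hcard, ← hleft, hdc]
  refine (Finset.sum_le_card_nsmul _ _ _ fun v _ => hv v).trans ?_
  simp

theorem extremalNumber_div_choose_succ_le {n : ℕ} (hn : k ≤ n) {F : KGraph k V}
    (hF : F.edges.Nonempty) :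
    (extremalNumber (n + 1) F : ℝ) / ((n + 1).choose k : ℝ)
      ≤ (extremalNumber n F : ℝ) / (n.choose k : ℝ) := by
  have h1 : (0 : ℝ) < (n + 1).choose k := by exact_mod_cast Nat.choose_pos (by omega)
  have h2 : (0 : ℝ) < n.choose k := by exact_mod_cast Nat.choose_pos hn
  rw [div_le_div_iff₀ h1 h2]
  have h3 : 0 < n + 1 - k := by omega
  have h4 := extremalNumber_succ_mul_le n hF
  have h5 := Nat.choose_mul_succ_eq n k
  have : extremalNumber (n + 1) F * n.choose k ≤ extremalNumber n F * (n + 1).choose k := by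
    refine Nat.le_of_mul_le_mul_right ?_ h3
    calc extremalNumber (n + 1) F * n.choose k * (n + 1 - k)
        = extremalNumber (n + 1) F * (n + 1 - k) * n.choose k := by ring
      _ ≤ (n + 1) * extremalNumber n F * n.choose k := Nat.mul_le_mul_right _ h4
      _ = extremalNumber n F * (n.choose k * (n + 1)) := by ring
      _ = _ := by rw [h5]; ring
  exact_mod_cast this

/-- Every hypergraph with an edge has a Turán density. -/
theorem exists_isTuranDensity {F : KGraph k V} (hF : F.edges.Nonempty) :
    ∃ x : ℝ, F.IsTuranDensity x := by
  have hanti : Antitone fun n : ℕ =>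
      (extremalNumber (n + k) F : ℝ) / ((n + k).choose k : ℝ) := by
    refine antitone_nat_of_succ_le fun n => ?_
    rw [show n + 1 + k = n + k + 1 by ring]
    exact extremalNumber_div_choose_succ_le (Nat.le_add_left k n) hF
  have hbdd : BddBelow (Set.range fun n : ℕ =>
      (extremalNumber (n + k) F : ℝ) / ((n + k).choose k : ℝ)) := by
    refine ⟨0, ?_⟩
    rintro _ ⟨n, rfl⟩
    positivity
  refine ⟨_, (tendsto_add_atTop_iff_nat k).mp (tendsto_atTop_ciInf hanti hbdd)⟩

end ExtremalNumber

end KGraph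

/-! ### Densities strictly below `r! / r ^ r`. -/

section UpperBound

open KGraph

theorem coneTree_edges_nonempty {r : ℕ} (hr : 2 ≤ r) {D : ℕ} (hD : 0 < D) :
    (coneTree (expansionEdges r) (card_of_mem_expansionEdges hr) D).edges.Nonempty := by
  classical
  obtain ⟨d, rfl⟩ : ∃ d, D = d + 1 := ⟨D - 1, by omega⟩
  have hp : (⟨0, by omega⟩ : Fin (r + 1)) < ⟨1, by omega⟩ :=
    Fin.mk_lt_mk.mpr Nat.zero_lt_one
  exact ⟨_, mem_coneTreeEdges_succ.mpr (Or.inl ⟨_, Finset.mem_image_of_mem _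
    (Finset.mem_univ ⟨(_, _), hp⟩), rfl⟩)⟩

theorem tendsto_pow_div_choose (k : ℕ) :
    Tendsto (fun n : ℕ => (n : ℝ) ^ k / (n.choose k : ℝ)) atTop (𝓝 (k.factorial : ℝ)) := by
  have hf : (k.factorial : ℝ) ≠ 0 := by exact_mod_cast Nat.factorial_ne_zero k
  have h := isEquivalent_choose k
  have h' : Tendsto (fun n : ℕ => ((n : ℝ) ^ k / k.factorial) / (n.choose k : ℝ)) atTop (𝓝 1) := by
    refine (Asymptotics.isEquivalent_iff_tendsto_one ?_).mp h.symm
    filter_upwards [eventually_ge_atTop k] with n hn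
    exact_mod_cast (Nat.choose_pos hn).ne'
  have h2 := h'.mul_const (k.factorial : ℝ)
  rw [one_mul] at h2
  refine h2.congr fun n => ?_
  field_simp

/-- The Turán density of the tree of cones over the expansion of the complete graph is less than
`r! / r ^ r`. -/
theorem isTuranDensity_coneTree_lt {r : ℕ} (hr : 2 ≤ r) {D : ℕ} (hD : 0 < D) {x : ℝ}
    (hx : (coneTree (expansionEdges r) (card_of_mem_expansionEdges hr) D).IsTuranDensity x) :
    x < r.factorial / (r : ℝ) ^ r := by
  obtain ⟨c, hc, hbound⟩ := exists_card_le_of_ranked hr hD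
  obtain ⟨C, hC⟩ := exists_ranked_subset hr hD
  have hr0 : (0 : ℝ) < r := by
    have : 0 < r := by omega
    exact_mod_cast this
  set b : ℝ := 1 / ((r + 1) * (r : ℝ) ^ r) with hb
  have hle : ∀ n : ℕ, (extremalNumber n
      (coneTree (expansionEdges r) (card_of_mem_expansionEdges hr) D) : ℝ)
      ≤ (b - c) * (n : ℝ) ^ (r + 1) + C * (n : ℝ) ^ r := by
    intro n
    obtain ⟨H, hH, hcard⟩ := exists_card_edges_eq_extremalNumber n (coneTree_edges_nonempty hr hD)
    obtain ⟨E, rk, h1, h2, h3, h4⟩ := hC (Fin n) H hH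
    have h5 := hbound (Fin n) E rk h1 h2 h3
    rw [Fintype.card_fin] at h4 h5
    rw [← hcard]
    refine le_trans (Nat.cast_le.mpr h4) ?_
    push_cast
    linarith
  have hlim : Tendsto (fun n : ℕ => ((b - c) + C * (1 / (n : ℝ))) *
      ((n : ℝ) ^ (r + 1) / (n.choose (r + 1) : ℝ))) atTop
      (𝓝 (((b - c) + C * 0) * ((r + 1).factorial : ℝ))) :=
    (tendsto_const_nhds.add (tendsto_const_nhds.mul tendsto_one_div_atTop_nhds_zero_nat)).mul
      (tendsto_pow_div_choose (r + 1))
  have hxle : x ≤ ((b - c) + C * 0) * ((r + 1).factorial : ℝ) := by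
    refine le_of_tendsto_of_tendsto hx hlim ?_
    filter_upwards [eventually_gt_atTop 0] with n hn
    have hn0 : (0 : ℝ) < n := by exact_mod_cast hn
    rw [← mul_div_assoc]
    refine div_le_div_of_nonneg_right ((hle n).trans (le_of_eq ?_)) (Nat.cast_nonneg _)
    field_simp
    ring
  have hfac : ((r + 1).factorial : ℝ) = (r + 1) * r.factorial := by
    rw [Nat.factorial_succ]; push_cast; ring
  have hfpos : (0 : ℝ) < r.factorial := by exact_mod_cast Nat.factorial_pos r
  have hbf : b * ((r + 1).factorial : ℝ) = r.factorial / (r : ℝ) ^ r := by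
    rw [hb, hfac]; field_simp
  have : 0 < c * ((r + 1).factorial : ℝ) := by rw [hfac]; positivity
  nlinarith

end UpperBound

/-! ### The level construction. -/

section LowerBound

open KGraph

/-- In a hypergraph whose edges consist of a vertex of lowest level and of vertices of distinct
colours, a tree of cones over the expansion of a complete graph is at most as deep as the level of
its root. -/
theorem le_level_of_isConeTreeCopy {W : Type} {r : ℕ} {E : Finset (Finset W)} {b : W → ℕ}
    {col : W → Fin r}
    (hE : ∀ e ∈ E, ∃ v ∈ e, (∀ x ∈ e, x ≠ v → b v < b x) ∧
      ∀ x ∈ e, ∀ y ∈ e, x ≠ v → y ≠ v → col x = col y → x = y) :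
    ∀ (d : ℕ) (v : W) (f : ConeTreeVert (ExpansionVert r) d ↪ W),
      IsConeTreeCopy (expansionEdges r) E d v f → d ≤ b v := by
  classical
  intro d
  induction d with
  | zero => exact fun v _ _ => Nat.zero_le _
  | succ d ih =>
    rintro v f ⟨rfl, hf⟩
    by_contra hlt
    have hbase : ∀ a, d ≤ b (f (coneTreeBase d a)) := fun a =>
      ih _ ((coneTreeBranch d a).trans f) ⟨rfl, fun e he => by
        rw [← Finset.map_map]
        exact hf _ (mem_coneTreeEdges_succ.mpr (Or.inr ⟨a, e, he, rfl⟩))⟩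
    have hroot : ∀ a, f (coneTreeBase d a) ≠ f (coneTreeRoot _ (d + 1)) := fun a h =>
      coneTreeBranch_ne_root a _ (f.injective h)
    have hdist : ∀ i j : Fin (r + 1), i < j →
        col (f (coneTreeBase d (Sum.inl i))) ≠ col (f (coneTreeBase d (Sum.inl j))) := by
      intro i j hij hcol
      have he := hf _ (mem_coneTreeEdges_succ.mpr (Or.inl ⟨expansionEdge r ⟨(i, j), hij⟩,
        Finset.mem_image_of_mem _ (Finset.mem_univ _), rfl⟩))
      obtain ⟨u, hu, hlow, hinj⟩ := hE _ he
      have hmem : ∀ a ∈ expansionEdge r ⟨(i, j), hij⟩, f (coneTreeBase d a) ∈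
          (insert (coneTreeRoot _ (d + 1))
            ((expansionEdge r ⟨(i, j), hij⟩).map (coneTreeBase d))).map f := fun a ha =>
        Finset.mem_map_of_mem _ (Finset.mem_insert_of_mem (Finset.mem_map_of_mem _ ha))
      -- Base vertices have level at least `d` and the root at most `d`, so none of them is strictly
      -- below the root.
      have hu' : u = f (coneTreeRoot _ (d + 1)) := by
        by_contra hne
        have h1 := hlow _ (Finset.mem_map_of_mem _ (Finset.mem_insert_self _ _)) (Ne.symm hne)
        obtain ⟨w, hw, rfl⟩ := Finset.mem_map.mp hu
        rcases Finset.mem_insert.mp hw with rfl | hw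
        · exact hne rfl
        · obtain ⟨a, -, rfl⟩ := Finset.mem_map.mp hw
          have := hbase a
          omega
      subst hu'
      have h2 := hinj _ (hmem (Sum.inl i) (by simp [expansionEdge])) _
        (hmem (Sum.inl j) (by simp [expansionEdge])) (hroot _) (hroot _) hcol
      have h3 := Sum.inl_injective ((coneTreeBase d).injective (f.injective h2))
      exact hij.ne h3
    have hinj : Function.Injective fun i : Fin (r + 1) =>
        col (f (coneTreeBase d (Sum.inl i))) := by
      intro i j hij
      by_contra hne
      rcases lt_or_gt_of_ne hne with h | h
      · exact hdist i j h hij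
      · exact hdist j i h hij.symm
    have := Fintype.card_le_of_injective _ hinj
    simp at this

/-- The edge with lowest vertex `q.2.1`, in the level `q.1`, and with the vertex `q.2.2 c` in each
colour class `c`. -/
def levelEdge {D r t : ℕ} (q : Σ _ : Fin D, (Fin r × Fin t) × (Fin r → Fin D × Fin t)) :
    Finset (Fin D × Fin r × Fin t) :=
  insert (q.1, q.2.1) (Finset.univ.map
    ⟨fun c => ((q.2.2 c).1, c, (q.2.2 c).2), fun c c' h => by
      simp only [Prod.mk.injEq] at h
      exact h.2.1⟩)

/-- The parameters for which `levelEdge` yields an edge. -/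
def levelParams (D r t : ℕ) :
    Finset (Σ _ : Fin D, (Fin r × Fin t) × (Fin r → Fin D × Fin t)) :=
  Finset.univ.sigma fun j => Finset.univ ×ˢ Fintype.piFinset fun _ => Finset.Ioi j ×ˢ Finset.univ

variable {D r t : ℕ}

theorem mem_levelParams {q : Σ _ : Fin D, (Fin r × Fin t) × (Fin r → Fin D × Fin t)} :
    q ∈ levelParams D r t ↔ ∀ c, q.1 < (q.2.2 c).1 := by
  simp [levelParams]

theorem mem_levelEdge {q : Σ _ : Fin D, (Fin r × Fin t) × (Fin r → Fin D × Fin t)}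
    {x : Fin D × Fin r × Fin t} :
    x ∈ levelEdge q ↔ x = (q.1, q.2.1) ∨ ∃ c, ((q.2.2 c).1, c, (q.2.2 c).2) = x := by
  rw [levelEdge, Finset.mem_insert, Finset.mem_map]
  exact or_congr_right ⟨fun ⟨c, _, hc⟩ => ⟨c, hc⟩, fun ⟨c, hc⟩ => ⟨c, Finset.mem_univ _, hc⟩⟩

theorem card_levelEdge {q : Σ _ : Fin D, (Fin r × Fin t) × (Fin r → Fin D × Fin t)}
    (hq : q ∈ levelParams D r t) : (levelEdge q).card = r + 1 := by
  rw [levelEdge, Finset.card_insert_of_notMem, Finset.card_map, Finset.card_univ, Fintype.card_fin]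
  intro h
  obtain ⟨c, -, hc⟩ := Finset.mem_map.mp h
  exact (mem_levelParams.mp hq c).ne' (congrArg Prod.fst hc)

/-- The lowest vertex is recognized by its level, and each other one by its colour; the lowest may
share its colour with another. -/
theorem injOn_levelEdge :
    Set.InjOn (levelEdge (D := D) (r := r) (t := t)) ↑(levelParams D r t) := by
  rintro ⟨j, p, h⟩ hq ⟨j', p', h'⟩ hq' heq
  have hq1 := mem_levelParams.mp hq
  have hq2 := mem_levelParams.mp hq'
  dsimp only at hq1 hq2
  have h1 : ((j, p) : Fin D × Fin r × Fin t) ∈ levelEdge ⟨j', p', h'⟩ :=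
    heq ▸ mem_levelEdge.mpr (Or.inl rfl)
  have h2 : ((j', p') : Fin D × Fin r × Fin t) ∈ levelEdge ⟨j, p, h⟩ :=
    heq ▸ mem_levelEdge.mpr (Or.inl rfl)
  have h3 : ((j, p) : Fin D × Fin r × Fin t) = (j', p') := by
    rcases mem_levelEdge.mp h1 with h1 | ⟨c, h1⟩
    · exact h1
    rcases mem_levelEdge.mp h2 with h2 | ⟨c', h2⟩
    · exact h2.symm
    have e1 : (h' c).1 = j := congrArg Prod.fst h1
    have e2 : (h c').1 = j' := congrArg Prod.fst h2
    have l1 := hq1 c'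
    have l2 := hq2 c
    rw [e2] at l1
    rw [e1] at l2
    exact absurd l1 l2.asymm
  obtain ⟨rfl, rfl⟩ := Prod.mk.inj h3
  have h4 : h = h' := by
    funext c
    have h5 : ((h c).1, c, (h c).2) ∈ levelEdge ⟨j, p, h'⟩ :=
      heq ▸ mem_levelEdge.mpr (Or.inr ⟨c, rfl⟩)
    rcases mem_levelEdge.mp h5 with h5 | ⟨c', h5⟩
    · exact absurd (congrArg Prod.fst h5) (hq1 c).ne'
    · simp only [Prod.mk.injEq] at h5
      obtain ⟨a1, rfl, a2⟩ := h5
      exact (Prod.ext a1 a2).symm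
  rw [h4]

/-- The hypergraph with `D` levels, each divided into `r` colour classes of size `t`, in which
every edge has its lowest vertex alone in its level, and the others of distinct colours. -/
def levelGraph (D r t : ℕ) : KGraph (r + 1) (Fin D × Fin r × Fin t) where
  edges := (levelParams D r t).image levelEdge
  uniform := by
    intro e he
    obtain ⟨q, hq, rfl⟩ := Finset.mem_image.mp he
    exact card_levelEdge hq

/-- Here `m` is the number of levels above the lowest vertex: `r * t` choices for that vertex and `m
* t` in each colour. -/
theorem card_edges_levelGraph (D r t : ℕ) :
    (levelGraph D r t).edges.card = r * t ^ (r + 1) * ∑ m ∈ Finset.range D, m ^ r := by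
  have h1 : (levelGraph D r t).edges.card = ∑ j : Fin D, r * t * ((D - 1 - j) * t) ^ r := by
    rw [levelGraph, Finset.card_image_of_injOn injOn_levelEdge, levelParams, Finset.card_sigma]
    simp
  rw [h1, Fin.sum_univ_eq_sum_range fun j => r * t * ((D - 1 - j) * t) ^ r,
    Finset.sum_range_reflect fun j => r * t * (j * t) ^ r, Finset.mul_sum]
  refine Finset.sum_congr rfl fun m _ => ?_
  rw [mul_pow]
  ring

theorem not_containsCopy_levelGraph (hr : 2 ≤ r) (D t : ℕ) :
    ¬ (levelGraph D r t).ContainsCopy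
      (coneTree (expansionEdges r) (card_of_mem_expansionEdges hr) D) := by
  rintro ⟨f, hf⟩
  refine absurd (le_level_of_isConeTreeCopy (b := fun x => (x.1 : ℕ)) (col := fun x => x.2.1) ?_ D _
    f ⟨rfl, hf⟩) (not_le.mpr (f _).1.isLt)
  intro e he
  obtain ⟨q, hq, rfl⟩ := Finset.mem_image.mp he
  have hq' := mem_levelParams.mp hq
  refine ⟨(q.1, q.2.1), mem_levelEdge.mpr (Or.inl rfl), ?_, ?_⟩
  · intro x hx hne
    rcases mem_levelEdge.mp hx with rfl | ⟨c, rfl⟩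
    · exact absurd rfl hne
    · exact hq' c
  · intro x hx y hy hnx hny hcol
    rcases mem_levelEdge.mp hx with rfl | ⟨c, rfl⟩
    · exact absurd rfl hnx
    rcases mem_levelEdge.mp hy with rfl | ⟨c', rfl⟩
    · exact absurd rfl hny
    dsimp only at hcol
    rw [hcol]

theorem succ_pow_succ_le (n r : ℕ) : (n + 1) ^ (r + 1) ≤ n ^ (r + 1) + (r + 1) * (n + 1) ^ r := by
  induction r with
  | zero => simp
  | succ r ih =>
    have h := Nat.pow_le_pow_left (Nat.le_succ n) (r + 1)
    calc (n + 1) ^ (r + 1 + 1) = (n + 1) * (n + 1) ^ (r + 1) := by ring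
      _ ≤ (n + 1) * (n ^ (r + 1) + (r + 1) * (n + 1) ^ r) := Nat.mul_le_mul_left _ ih
      _ = n ^ (r + 1 + 1) + (r + 1) * (n + 1) ^ (r + 1) + n ^ (r + 1) := by ring
      _ ≤ n ^ (r + 1 + 1) + (r + 1) * (n + 1) ^ (r + 1) + (n + 1) ^ (r + 1) :=
        Nat.add_le_add_left h _
      _ = _ := by ring

/-- A discrete form of comparing the sum with the integral of `x ^ r`. -/
theorem pow_succ_le_mul_sum_range_pow (n r : ℕ) :
    n ^ (r + 1) ≤ (r + 1) * ∑ m ∈ Finset.range (n + 1), m ^ r := by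
  induction n with
  | zero => simp
  | succ n ih =>
    rw [Finset.sum_range_succ, mul_add]
    exact (succ_pow_succ_le n r).trans (Nat.add_le_add_right ih _)

/-- A lower bound for the Turán density of the tree of cones of depth `n + 1`. -/
theorem le_of_isTuranDensity_coneTree (hr : 2 ≤ r) (n : ℕ) {x : ℝ}
    (hx : (coneTree (expansionEdges r) (card_of_mem_expansionEdges hr) (n + 1)).IsTuranDensity x) :
    r.factorial / (r : ℝ) ^ r * ((n : ℝ) / (n + 1)) ^ (r + 1) ≤ x := by
  have hr0 : 0 < r := by omega
  -- The limit exists by hypothesis, so the vertex numbers of the level graphs suffice as a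
  -- subsequence.
  have hsub : Tendsto (fun t : ℕ => (n + 1) * (r * t)) atTop atTop :=
    tendsto_atTop_mono (fun t =>
      (Nat.le_mul_of_pos_left t hr0).trans (Nat.le_mul_of_pos_left _ n.succ_pos)) tendsto_id
  refine ge_of_tendsto (hx.comp hsub) ?_
  filter_upwards [eventually_ge_atTop 2] with t ht
  set N := (n + 1) * (r * t) with hN
  have hkN : r + 1 ≤ N := by nlinarith [Nat.zero_le (n * (r * t))]
  have hc : (0 : ℝ) < N.choose (r + 1) := by exact_mod_cast Nat.choose_pos hkN
  have h1 : (levelGraph (n + 1) r t).edges.card ≤ extremalNumber N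
      (coneTree (expansionEdges r) (card_of_mem_expansionEdges hr) (n + 1)) :=
    card_edges_le_extremalNumber (by simp [hN]) (not_containsCopy_levelGraph hr _ _)
  rw [card_edges_levelGraph] at h1
  have h2 : r * t ^ (r + 1) * n ^ (r + 1) ≤ (r + 1) * extremalNumber N
      (coneTree (expansionEdges r) (card_of_mem_expansionEdges hr) (n + 1)) := by
    calc r * t ^ (r + 1) * n ^ (r + 1)
        ≤ r * t ^ (r + 1) * ((r + 1) * ∑ m ∈ Finset.range (n + 1), m ^ r) :=
          Nat.mul_le_mul_left _ (pow_succ_le_mul_sum_range_pow n r)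
      _ = (r + 1) * (r * t ^ (r + 1) * ∑ m ∈ Finset.range (n + 1), m ^ r) := by ring
      _ ≤ _ := Nat.mul_le_mul_left _ h1
  have h3 : (r : ℝ) * (t : ℝ) ^ (r + 1) * (n : ℝ) ^ (r + 1) ≤ (r + 1) * (extremalNumber N
      (coneTree (expansionEdges r) (card_of_mem_expansionEdges hr) (n + 1)) : ℝ) := by
    exact_mod_cast h2
  have h4 : (N.choose (r + 1) : ℝ) ≤ (N : ℝ) ^ (r + 1) / ((r + 1).factorial : ℝ) :=
    Nat.choose_le_pow_div (r + 1) N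
  have hr1 : (0 : ℝ) < r := by exact_mod_cast hr0
  have ht1 : (0 : ℝ) < t := by exact_mod_cast (by omega : 0 < t)
  have hf : (0 : ℝ) < r.factorial := by exact_mod_cast Nat.factorial_pos r
  rw [Function.comp_apply, le_div_iff₀ hc]
  refine (mul_le_mul_of_nonneg_left h4 (by positivity)).trans ?_
  have h5 : (r.factorial / (r : ℝ) ^ r * ((n : ℝ) / (n + 1)) ^ (r + 1)) *
      ((N : ℝ) ^ (r + 1) / ((r + 1).factorial : ℝ))
      = (r : ℝ) * (t : ℝ) ^ (r + 1) * (n : ℝ) ^ (r + 1) / (r + 1) := by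
    rw [hN, Nat.factorial_succ, div_pow]
    push_cast
    rw [mul_pow, mul_pow]
    field_simp
    ring
  rw [h5, div_le_iff₀ (by positivity), mul_comm _ ((r : ℝ) + 1)]
  exact h3

end LowerBound

/-! ### The accumulation point. -/

theorem exists_mem_turanDensitySet {r : ℕ} (hr : 2 ≤ r) (n : ℕ) :
    ∃ x ∈ turanDensitySet (r + 1), x < r.factorial / (r : ℝ) ^ r ∧
      r.factorial / (r : ℝ) ^ r * ((n : ℝ) / (n + 1)) ^ (r + 1) ≤ x := by
  obtain ⟨x, hx⟩ := KGraph.exists_isTuranDensity (coneTree_edges_nonempty hr n.succ_pos)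
  exact ⟨x, ⟨_, inferInstance, _, hx⟩, isTuranDensity_coneTree_lt hr n.succ_pos hx,
    le_of_isTuranDensity_coneTree hr n hx⟩

/-- The densities are squeezed to `r! / r ^ r`, and the strict upper bound keeps them different from
it. -/
theorem accPt_turanDensitySet {r : ℕ} (hr : 2 ≤ r) :
    AccPt ((r.factorial : ℝ) / (r : ℝ) ^ r) (𝓟 (turanDensitySet (r + 1))) := by
  choose x hx hlt hle using exists_mem_turanDensitySet hr
  have hlim : Tendsto (fun n : ℕ => (r.factorial : ℝ) / (r : ℝ) ^ r *
      ((n : ℝ) / (n + 1)) ^ (r + 1)) atTop (𝓝 ((r.factorial : ℝ) / (r : ℝ) ^ r)) := by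
    simpa using ((tendsto_natCast_div_add_atTop (1 : ℝ)).pow (r + 1)).const_mul
      ((r.factorial : ℝ) / (r : ℝ) ^ r)
  have hxlim : Tendsto x atTop (𝓝 ((r.factorial : ℝ) / (r : ℝ) ^ r)) :=
    tendsto_of_tendsto_of_tendsto_of_le_of_le hlim tendsto_const_nhds hle fun n => (hlt n).le
  rw [accPt_iff_nhds]
  intro U hU
  obtain ⟨n, hn⟩ := (hxlim.eventually hU).exists
  exact ⟨x n, ⟨hn, hx n⟩, (hlt n).ne⟩

theorem factorial_lt_pow_self {r : ℕ} (hr : 2 ≤ r) : r.factorial < r ^ r := by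
  obtain ⟨s, rfl⟩ : ∃ s, r = s + 1 := ⟨r - 1, by omega⟩
  rw [Nat.factorial_succ, pow_succ']
  refine Nat.mul_lt_mul_of_pos_left ?_ s.succ_pos
  exact (Nat.factorial_le_pow s).trans_lt (Nat.pow_lt_pow_left s.lt_succ_self (by omega))

theorem theorem1p1 :
    (∀ k : ℕ, 3 ≤ k → ∃ α ∈ Set.Ico (0 : ℝ) 1, AccPt α (𝓟 (turanDensitySet k))) ∧
      AccPt (1 / 2 : ℝ) (𝓟 (turanDensitySet 3)) := by
  refine ⟨fun k hk => ?_, ?_⟩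
  · obtain ⟨r, rfl⟩ : ∃ r, k = r + 1 := ⟨k - 1, by omega⟩
    have hr : 2 ≤ r := by omega
    refine ⟨_, ⟨by positivity, ?_⟩, accPt_turanDensitySet hr⟩
    have h : (0 : ℝ) < (r : ℝ) ^ r := by
      have : 0 < r := by omega
      positivity
    rw [div_lt_one h]
    exact_mod_cast factorial_lt_pow_self hr
  · convert accPt_turanDensitySet le_rfl using 1
    norm_num [Nat.factorial]
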